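/- \textbf{Setting.} Let $n\ge 2$ and let $h(t)=\frac16 k_{abc}t^at^bt^c$ be a real homogeneous cubic polynomial on $\mathbb R^{n-1}$ ($k_{abc}$ symmetric). Let $\mathcal H\subset\{h=1\}\subset\mathbb R^{n-1}$ be a projective special real manifold, that is, a non-empty hypersurface such that $-\partial^2h$ is positive definite on $T\mathcal H$. Put $U=\mathbb R_{>0}\cdot\mathcal H$, $$M=\{X=X^0\cdot(1,z)\in\mathbb C^n\mid X^0\in\mathbb C^*,\ z\in\mathbb R^{n-1}+iU\},\qquad \mathfrak F(X)=-\frac{h(X^1,\dots,X^{n-1})}{X^0},\qquad \tau_{ij}=\frac{\partial^2\mathfrak F}{\partial X^i\partial X^j}.$$ Then $M$ is a conical affine special Kähler manifold with metric $g=\operatorname{Im}(\tau_{ij})\,dX^id\bar X^j$, standard complex structure $J$, Kähler form $\omega=g(J\cdot,\cdot)$, Euler field $\xi_X=X$, and flat connection $\nabla$ with global parallel coframe $dx^i=\operatorname{Re}dX^i$, $dy_i=-\operatorname{Re}d(\partial\mathfrak F/\partial X^i)$. Let $\Gamma_\nabla\cong\mathbb R^{2n}$ be the space of real linear combinations of the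 $dx^i$ and $dy_i$. Write also $\omega^{-1}$ for the inverse of $v\mapsto\omega(v,\cdot)$, and $\omega^{-1}(\alpha,\beta)=\omega(\omega^{-1}\alpha,\omega^{-1}\beta)$ for the corresponding symplectic form on covectors; it is constant on $\Gamma_\nabla\times\Gamma_\nabla$. On $N=T^*M$, with $TN\cong\pi^*TM\oplus\pi^*T^*M$ by means of $\nabla$, put $g_N=\operatorname{diag}(g,g^{-1})$, $I_1=\operatorname{diag}(J,J^*)$, $I_2(v,\gamma)=(-\omega^{-1}\gamma,\omega(v,\cdot))$, $I_3=I_1I_2$, $\omega_k=g_N(I_k\cdot,\cdot)$, let $Z$ be the $\nabla$-horizontal lift of $-J\xi$, and put $\omega_{\mathrm H}=\omega_1+d\iota_Zg_N$, $f_Z^c=-\frac12g_N(Z,Z)-\frac12c$, $f_{\mathrm H}^c=f_Z^c+g_N(Z,Z)$. On $P=N\times S^1$, $S^1=\mathbb R/2\pi\mathbb Z\ni s$, put $\eta=ds+\frac12\iota_\Xi\omega_{\mathrm H}$, where $\Xi$ is the horizontal lift of $\xi$ plus the fibrewise Euler field, and $\theta_0=df_Z^c$, $\theta_1=\eta-\iota_Zg_N$,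 $\theta_2=-\iota_Z\omega_3$, $\theta_3=\iota_Z\omega_2$. The one-loop deformed q-map space is the $4n$-dimensional manifold $$\bar N=\{\arg X^0=0,\ f_Z^c>0\}\subset P,\qquad g^c_{\bar N}=\frac1{4|f_Z^c|}\Big(-\frac1{f^c_{\mathrm H}}\eta^2+g_N+\frac1{f_Z^c}\sum_{j=0}^3\theta_j^2\Big)\Big|_{\bar N}.$$ \textbf{Groups.} Let $\operatorname{Aut}(\mathcal H)=\{A\in GL(n-1,\mathbb R)\mid A\mathcal H=\mathcal H\}$ and $\mathrm{Aff}_{\mathcal H}(\mathbb R^{n-1})=(\mathbb R_{>0}\times\operatorname{Aut}(\mathcal H))\ltimes\mathbb R^{n-1}$, where $(r,A)$ acts on $\mathbb R^{n-1}$ by $b\mapsto rAb$. An element $(r,A,b)$ acts on $M$ by $$(X^0,\vec X)\mapsto(r^{-3/2}X^0,\ r^{-1/2}A\vec X+r^{-3/2}X^0b),$$ which covers $z\mapsto rAz+b$. Let $\mathrm{Heis}_{2n+1}=\Gamma_\nabla\times\mathbb R$ with product $(\alpha_1,\tau_1)(\alpha_2,\tau_2)=(\alpha_1+\alpha_2,\tau_1+\tau_2+\frac12\omega^{-1}(\alpha_1,\alpha_2))$,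 and let $\mathcal F=\{0\}\times2\pi\mathbb Z$, an infinite cyclic subgroup of its centre. $\mathrm{Aff}_{\mathcal H}(\mathbb R^{n-1})$ acts on $\mathrm{Heis}_{2n+1}/\mathcal F$ by automorphisms $(\alpha,\tau)\mapsto(g_*\alpha,\tau)$, with $g_*=(g^{-1})^*$. \textbf{Theorem.} For every $c\ge0$ the formulas $$g\cdot(\beta,s)=(g_*\beta,s),\qquad(\alpha,\tau)\cdot(\beta,s)=\big(\alpha(p)+\beta,\ s+\tau+\tfrac12\omega^{-1}(\alpha(p),\beta)\bmod 2\pi\big)$$ for $g\in\mathrm{Aff}_{\mathcal H}(\mathbb R^{n-1})$, $(\alpha,\tau)\in\mathrm{Heis}_{2n+1}$, $\beta\in T_p^*M$, define an action of the group $\mathrm{Aff}_{\mathcal H}(\mathbb R^{n-1})\ltimes(\mathrm{Heis}_{2n+1}/\mathcal F)$ on $\bar N$. This action is effective, and every element acts as an isometry (a diffeomorphism preserving the metric) of $(\bar N,g^c_{\bar N})$. -/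

import Mathlib

open scoped ContDiff Matrix ComplexConjugate

namespace QMap

noncomputable section

/-! ### Projective special real manifolds -/

/-- The trilinear form `k_{abc} u^a v^b w^c`. -/
def tri {m : ℕ} (k : Fin m → Fin m → Fin m → ℝ) (u v w : Fin m → ℝ) : ℝ :=
  ∑ a, ∑ b, ∑ c, k a b c * u a * v b * w c

/-- The homogeneous cubic polynomial `h(t) = (1/6) k_{abc} t^a t^b t^c`. -/
def cubic {m : ℕ} (k : Fin m → Fin m → Fin m → ℝ) (t : Fin m → ℝ) : ℝ :=
  (1 / 6) * tri k t t t

/-- A projective special real manifold `H ⊆ {h = 1} ⊆ ℝᵐ`, with `m = n - 1`.  By Euler's relation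
`dh ≠ 0` along `{h = 1}`, so a hypersurface contained in `{h = 1}` is the same thing as a relatively
open subset of `{h = 1}`.  Since `dh_t(v) = (1/2) k(t,t,v)` and `∂²h_t(v,v) = k(t,v,v)`, the field
`riemannian` says that `-∂²h` is positive definite on the tangent spaces of `H`. -/
structure PSR (m : ℕ) where
  /-- the coefficients of the cubic -/
  k : Fin m → Fin m → Fin m → ℝ
  symm_left : ∀ a b c, k a b c = k b a c
  symm_right : ∀ a b c, k a b c = k a c b
  /-- the hypersurface -/
  H : Set (Fin m → ℝ)
  nonempty : H.Nonempty
  hypersurface : ∃ V : Set (Fin m → ℝ), IsOpen V ∧ H = V ∩ {t | cubic k t = 1}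
  riemannian : ∀ t ∈ H, ∀ v : Fin m → ℝ, v ≠ 0 → tri k t t v = 0 → 0 < -tri k t v v

variable {m : ℕ}

/-- `Aut(H) = {A ∈ GL(n-1,ℝ) | A H = H}`. -/
def autH (S : PSR m) : Subgroup (GL (Fin m) ℝ) where
  carrier := {A | (fun t => A.val *ᵥ t) '' S.H = S.H}
  one_mem' := by simp
  mul_mem' := by
    intro A B hA hB
    simp only [Set.mem_ofPred_eq] at *
    conv_rhs => rw [← hA, ← hB, Set.image_image]
    simp
  inv_mem' := by
    intro A hA
    simp only [Set.mem_ofPred_eq] at *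
    conv_lhs => rw [← hA, Set.image_image]
    have h : A.val⁻¹ * A.val = 1 := by
      rw [← Matrix.coe_units_inv]; simp
    simp [h]

/-- The group `ℝ_{>0}`. -/
abbrev PosReal : Type := {r : ℝ // 0 < r}

/-- The linear action `(r, A) · b = r A b` of `ℝ_{>0} × Aut(H)` on `ℝⁿ⁻¹`. -/
def linAct (S : PSR m) (x : PosReal × autH S) (b : Fin m → ℝ) : Fin m → ℝ :=
  x.1.val • (x.2.val.val *ᵥ b)

theorem linAct_one (S : PSR m) (b : Fin m → ℝ) : linAct S 1 b = b := by
  simp [linAct]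

theorem linAct_mul (S : PSR m) (x y : PosReal × autH S) (b : Fin m → ℝ) :
    linAct S (x * y) b = linAct S x (linAct S y b) := by
  simp [linAct, Matrix.mulVec_smul, smul_smul, Matrix.mulVec_mulVec]

theorem linAct_add (S : PSR m) (x : PosReal × autH S) (b c : Fin m → ℝ) :
    linAct S x (b + c) = linAct S x b + linAct S x c := by
  simp [linAct, Matrix.mulVec_add]

/-- `linAct` as a homomorphism into the automorphisms of the additive group `ℝⁿ⁻¹`. -/
def linHom (S : PSR m) : PosReal × autH S →* MulAut (Multiplicative (Fin m → ℝ)) where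
  toFun x :=
    { toFun := fun b => Multiplicative.ofAdd (linAct S x b.toAdd)
      invFun := fun b => Multiplicative.ofAdd (linAct S x⁻¹ b.toAdd)
      left_inv := fun b => by simp [← linAct_mul, linAct_one]
      right_inv := fun b => by simp [← linAct_mul, linAct_one]
      map_mul' := fun b c => by simp [linAct_add] }
  map_one' := by ext b; simp [linAct_one]
  map_mul' x y := by ext b; simp [linAct_mul]

/-- `Aff_H(ℝⁿ⁻¹) = (ℝ_{>0} × Aut(H)) ⋉ ℝⁿ⁻¹`. -/
abbrev AffH (S : PSR m) : Type :=
  Multiplicative (Fin m → ℝ) ⋊[linHom S] (PosReal × autH S)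

/-! ### The Heisenberg group -/

/-- Coefficient vectors `(a, a')` of the parallel one-forms `∑ aᵢ dxⁱ + ∑ a'ⁱ dyᵢ`, that is
`ℝ²ⁿ ≅ Γ_∇(T*M)`. -/
abbrev Par (m : ℕ) : Type := (Fin (m + 1) → ℝ) × (Fin (m + 1) → ℝ)

/-- The (constant) value of `ω⁻¹` on parallel one-forms, `ω = ∑ dxⁱ ∧ dyᵢ`. -/
def sympl (u v : Par m) : ℝ := u.1 ⬝ᵥ v.2 - u.2 ⬝ᵥ v.1

/-- The underlying set `ℝ²ⁿ × ℝ` of `Heis_{2n+1}`, `n = m + 1`. -/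
@[ext]
structure Heis (m : ℕ) where
  /-- the parallel one-form -/
  form : Par m
  /-- the central coordinate -/
  ctr : ℝ

instance : Mul (Heis m) :=
  ⟨fun x y => ⟨x.form + y.form, x.ctr + y.ctr + (1 / 2) * sympl x.form y.form⟩⟩

instance : One (Heis m) := ⟨⟨0, 0⟩⟩

instance : Inv (Heis m) := ⟨fun x => ⟨-x.form, -x.ctr⟩⟩

@[simp] theorem Heis.mul_form (x y : Heis m) : (x * y).form = x.form + y.form := rfl
@[simp] theorem Heis.mul_ctr (x y : Heis m) :
    (x * y).ctr = x.ctr + y.ctr + (1 / 2) * sympl x.form y.form := rfl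
@[simp] theorem Heis.one_form : (1 : Heis m).form = 0 := rfl
@[simp] theorem Heis.one_ctr : (1 : Heis m).ctr = 0 := rfl
@[simp] theorem Heis.inv_form (x : Heis m) : x⁻¹.form = -x.form := rfl
@[simp] theorem Heis.inv_ctr (x : Heis m) : x⁻¹.ctr = -x.ctr := rfl

instance : Group (Heis m) :=
  Group.ofLeftAxioms
    (fun x y z => by
      ext1
      · simp [add_assoc]
      · simp [sympl]; ring)
    (fun x => by ext1 <;> simp [sympl])
    (fun x => by
      ext1
      · simp
      · simp [sympl, dotProduct_comm])

/-- The infinite cyclic subgroup `F = {0} × 2πℤ` of the centre of the Heisenberg group. -/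
def cyc (m : ℕ) : Subgroup (Heis m) := Subgroup.zpowers ⟨0, 2 * Real.pi⟩

theorem cyc_le_center : cyc m ≤ Subgroup.center (Heis m) := by
  rw [cyc, Subgroup.zpowers_le, Subgroup.mem_center_iff]
  intro x
  ext1
  · simp
  · simp [sympl, add_comm]

instance : (cyc m).Normal where
  conj_mem x hx y := by
    have h := Subgroup.mem_center_iff.1 (cyc_le_center hx) y
    rw [h]; simpa using hx

/-! ### The action of `Aff_H` on parallel one-forms -/

/-- `(contr k u v)_c = k_{abc} u^a v^b`. -/
def contr (k : Fin m → Fin m → Fin m → ℝ) (u v : Fin m → ℝ) : Fin m → ℝ :=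
  fun c => ∑ a, ∑ b, k a b c * u a * v b

theorem contr_dot (k : Fin m → Fin m → Fin m → ℝ) (u v w : Fin m → ℝ) :
    contr k u v ⬝ᵥ w = tri k u v w := by
  simp only [contr, tri, dotProduct, Finset.sum_mul]
  rw [Finset.sum_comm]
  exact Finset.sum_congr rfl fun a _ => Finset.sum_comm

theorem tri_swap_left (S : PSR m) (u v w : Fin m → ℝ) : tri S.k u v w = tri S.k v u w := by
  simp only [tri]
  rw [Finset.sum_comm]
  refine Finset.sum_congr rfl fun a _ => Finset.sum_congr rfl fun b _ =>
    Finset.sum_congr rfl fun c _ => ?_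
  rw [S.symm_left b a c]; ring

theorem tri_swap_right (S : PSR m) (u v w : Fin m → ℝ) : tri S.k u v w = tri S.k u w v := by
  simp only [tri]
  refine Finset.sum_congr rfl fun a _ => ?_
  rw [Finset.sum_comm]
  refine Finset.sum_congr rfl fun b _ => Finset.sum_congr rfl fun c _ => ?_
  rw [S.symm_right a c b]; ring

theorem tri_add_right (k : Fin m → Fin m → Fin m → ℝ) (u v w w' : Fin m → ℝ) :
    tri k u v (w + w') = tri k u v w + tri k u v w' := by
  simp only [← contr_dot, dotProduct_add]

theorem tri_smul_right (k : Fin m → Fin m → Fin m → ℝ) (u v w : Fin m → ℝ) (r : ℝ) :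
    tri k u v (r • w) = r * tri k u v w := by
  simp only [← contr_dot, dotProduct_smul, smul_eq_mul]

theorem tri_add_mid (S : PSR m) (u v v' w : Fin m → ℝ) :
    tri S.k u (v + v') w = tri S.k u v w + tri S.k u v' w := by
  rw [tri_swap_right, tri_add_right, tri_swap_right S u v, tri_swap_right S u v']

theorem tri_smul_mid (S : PSR m) (u v w : Fin m → ℝ) (r : ℝ) :
    tri S.k u (r • v) w = r * tri S.k u v w := by
  rw [tri_swap_right, tri_smul_right, tri_swap_right S u v]

theorem tri_add_left (S : PSR m) (u u' v w : Fin m → ℝ) :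
    tri S.k (u + u') v w = tri S.k u v w + tri S.k u' v w := by
  rw [tri_swap_left, tri_add_mid, tri_swap_left S u v, tri_swap_left S u' v]

theorem tri_smul_left (S : PSR m) (u v w : Fin m → ℝ) (r : ℝ) :
    tri S.k (r • u) v w = r * tri S.k u v w := by
  rw [tri_swap_left, tri_smul_mid, tri_swap_left S u v]

theorem dot_ext {u v : Fin m → ℝ} (h : ∀ w, u ⬝ᵥ w = v ⬝ᵥ w) : u = v :=
  dotProduct_eq u v h

theorem contr_add_left (S : PSR m) (u u' v : Fin m → ℝ) :
    contr S.k (u + u') v = contr S.k u v + contr S.k u' v :=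
  dot_ext fun w => by simp only [add_dotProduct, contr_dot, tri_add_left]

theorem contr_add_right (S : PSR m) (u v v' : Fin m → ℝ) :
    contr S.k u (v + v') = contr S.k u v + contr S.k u v' :=
  dot_ext fun w => by simp only [add_dotProduct, contr_dot, tri_add_mid]

theorem contr_smul_left (S : PSR m) (u v : Fin m → ℝ) (r : ℝ) :
    contr S.k (r • u) v = r • contr S.k u v :=
  dot_ext fun w => by simp only [smul_dotProduct, contr_dot, tri_smul_left, smul_eq_mul]

theorem contr_smul_right (S : PSR m) (u v : Fin m → ℝ) (r : ℝ) :
    contr S.k u (r • v) = r • contr S.k u v :=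
  dot_ext fun w => by simp only [smul_dotProduct, contr_dot, tri_smul_mid, smul_eq_mul]

theorem contr_comm (S : PSR m) (u v : Fin m → ℝ) : contr S.k u v = contr S.k v u :=
  dot_ext fun w => by simp only [contr_dot, tri_swap_left]

theorem cubic_smul (S : PSR m) (r : ℝ) (t : Fin m → ℝ) :
    cubic S.k (r • t) = r ^ 3 * cubic S.k t := by
  simp only [cubic, tri_smul_left, tri_smul_mid, tri_smul_right]; ring

theorem cubic_continuous (S : PSR m) : Continuous (cubic S.k) := by
  unfold cubic tri; fun_prop

theorem cubic_line (S : PSR m) (t u : Fin m → ℝ) (x : ℝ) :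
    cubic S.k (t + x • u) = cubic S.k t + x * (tri S.k t t u / 2) + x ^ 2 * (tri S.k t u u / 2)
      + x ^ 3 * cubic S.k u := by
  simp only [cubic, tri_add_left, tri_add_mid, tri_add_right, tri_smul_left, tri_smul_mid,
    tri_smul_right]
  rw [tri_swap_left S u t t, tri_swap_right S t u t, tri_swap_left S u t u,
    tri_swap_right S u u t, tri_swap_left S u t u]
  ring

/-- An element of `Aut(H)` preserves the cubic polynomial. -/
theorem cubic_autH (S : PSR m) (A : autH S) (u : Fin m → ℝ) :
    cubic S.k (A.val.val *ᵥ u) = cubic S.k u := by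
  obtain ⟨t, ht⟩ := S.nonempty
  obtain ⟨V, hV, hH⟩ := S.hypersurface
  have htV : t ∈ V := by rw [hH] at ht; exact ht.1
  have ht1 : cubic S.k t = 1 := by rw [hH] at ht; exact ht.2
  let s : ℝ → ℝ := fun x => (cubic S.k (t + x • u)) ^ (-(1 / 3) : ℝ)
  have hc : Continuous fun x : ℝ => cubic S.k (t + x • u) :=
    (cubic_continuous S).comp (by fun_prop)
  have hpos : ∀ᶠ x in nhds (0 : ℝ), 0 < cubic S.k (t + x • u) :=
    hc.continuousAt.eventually (lt_mem_nhds (by simp [ht1]))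
  have hsc : ContinuousAt (fun x => s x • (t + x • u)) 0 := by
    have hl : Continuous fun x : ℝ => t + x • u := by fun_prop
    have hs : ContinuousAt s 0 := hc.continuousAt.rpow_const (Or.inl (by simp [ht1]))
    exact hs.smul hl.continuousAt
  have hmem : ∀ᶠ x in nhds (0 : ℝ), s x • (t + x • u) ∈ V :=
    hsc.eventually (hV.mem_nhds (by simpa [s, ht1] using htV))
  have key : ∀ᶠ x in nhds (0 : ℝ),
      cubic S.k (A.val.val *ᵥ (t + x • u)) = cubic S.k (t + x • u) := by
    filter_upwards [hpos, hmem] with x hx hxV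
    have hs : s x ^ 3 * cubic S.k (t + x • u) = 1 := by
      have : s x ^ 3 = (cubic S.k (t + x • u))⁻¹ := by
        simp only [s]
        rw [← Real.rpow_natCast, ← Real.rpow_mul hx.le]
        norm_num [Real.rpow_neg_one]
      rw [this, inv_mul_cancel₀ hx.ne']
    have h1 : s x • (t + x • u) ∈ S.H := by
      rw [hH]; exact ⟨hxV, by show cubic S.k _ = 1; rw [cubic_smul, hs]⟩
    have h2 : A.val.val *ᵥ (s x • (t + x • u)) ∈ S.H := by
      have hA : (fun t => A.val.val *ᵥ t) '' S.H = S.H := A.2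
      rw [← hA]; exact ⟨_, h1, rfl⟩
    rw [hH] at h2
    have h3 : cubic S.k (A.val.val *ᵥ (s x • (t + x • u))) = 1 := h2.2
    rw [Matrix.mulVec_smul, cubic_smul] at h3
    have h4 : s x ^ 3 ≠ 0 := fun h => by simp [h] at hs
    exact mul_left_cancel₀ h4 (h3.trans hs.symm)
  obtain ⟨e, he, hball⟩ := Metric.eventually_nhds_iff.1 key
  have hx : ∀ x : ℝ, |x| < e → cubic S.k (A.val.val *ᵥ t) + x * (tri S.k (A.val.val *ᵥ t)
      (A.val.val *ᵥ t) (A.val.val *ᵥ u) / 2) + x ^ 2 * (tri S.k (A.val.val *ᵥ t)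
      (A.val.val *ᵥ u) (A.val.val *ᵥ u) / 2) + x ^ 3 * cubic S.k (A.val.val *ᵥ u)
      = cubic S.k t + x * (tri S.k t t u / 2) + x ^ 2 * (tri S.k t u u / 2)
      + x ^ 3 * cubic S.k u := by
    intro x hx
    have := hball (y := x) (by simpa using hx)
    rwa [Matrix.mulVec_add, Matrix.mulVec_smul, cubic_line, cubic_line] at this
  have e1 := hx (e / 4) (by rw [abs_of_pos (by positivity)]; linarith)
  have e2 := hx (-(e / 4)) (by rw [abs_neg, abs_of_pos (by positivity)]; linarith)
  have e3 := hx (e / 2) (by rw [abs_of_pos (by positivity)]; linarith)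
  have e4 := hx (-(e / 2)) (by rw [abs_neg, abs_of_pos (by positivity)]; linarith)
  have h5 : e ^ 3 * cubic S.k (A.val.val *ᵥ u) = e ^ 3 * cubic S.k u := by
    linear_combination (e3 - e4 - 2 * e1 + 2 * e2) * (16 / 3)
  exact mul_left_cancel₀ (by positivity) h5

theorem tri_eq_cubic (S : PSR m) (u v w : Fin m → ℝ) :
    tri S.k u v w = cubic S.k (u + v + w) - cubic S.k (u + v) - cubic S.k (u + w)
      - cubic S.k (v + w) + cubic S.k u + cubic S.k v + cubic S.k w := by
  have p := tri_swap_left S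
  have q := tri_swap_right S
  simp only [cubic, tri_add_left, tri_add_mid, tri_add_right]
  rw [p v u u, q u v u, p w u u, q u w u, p v u v, q v v u, p v u v, p w u w, q w w u, p w u w,
    p w v v, q v w v, p w v w, q w w v, p w v w, q u w v, p v u w, q v w u, p v u w,
    p w u v, q u w v, p w v u, q v w u, p v u w]
  ring

/-- An element of `Aut(H)` preserves the trilinear form. -/
theorem tri_autH (S : PSR m) (A : autH S) (u v w : Fin m → ℝ) :
    tri S.k (A.val.val *ᵥ u) (A.val.val *ᵥ v) (A.val.val *ᵥ w) = tri S.k u v w := by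
  simp only [tri_eq_cubic, ← Matrix.mulVec_add, cubic_autH]

theorem inv_mul_val (A : GL (Fin m) ℝ) : (A⁻¹).val * A.val = 1 := by
  rw [← Units.val_mul]; simp

theorem mul_inv_val (A : GL (Fin m) ℝ) : A.val * (A⁻¹).val = 1 := by
  rw [← Units.val_mul]; simp

theorem contr_autH (S : PSR m) (A : autH S) (u v : Fin m → ℝ) :
    contr S.k (A.val.val *ᵥ u) (A.val.val *ᵥ v) = (A.val⁻¹).valᵀ *ᵥ contr S.k u v := by
  refine dot_ext fun w => ?_
  have hw : w = A.val.val *ᵥ ((A.val⁻¹).val *ᵥ w) := by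
    rw [Matrix.mulVec_mulVec, mul_inv_val, Matrix.one_mulVec]
  rw [Matrix.mulVec_transpose, ← Matrix.dotProduct_mulVec, contr_dot, contr_dot]
  conv_lhs => rw [hw]
  rw [tri_autH]

theorem dot_autH (A : GL (Fin m) ℝ) (u v : Fin m → ℝ) :
    ((A⁻¹).valᵀ *ᵥ u) ⬝ᵥ (A.val *ᵥ v) = u ⬝ᵥ v := by
  rw [Matrix.mulVec_transpose, ← Matrix.dotProduct_mulVec, Matrix.mulVec_mulVec, inv_mul_val,
    Matrix.one_mulVec]

/-- Push-forward of parallel one-forms under `(X⁰, X) ↦ (r^{-3/2} X⁰, r^{-1/2} A X)`. -/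
def pushLin (S : PSR m) (x : PosReal × autH S) (u : Par m) : Par m :=
  (Fin.cons (x.1.val ^ (3 / 2 : ℝ) * u.1 0)
      (x.1.val ^ (1 / 2 : ℝ) • ((x.2.val⁻¹).valᵀ *ᵥ Fin.tail u.1)),
   Fin.cons (x.1.val ^ (-(3 / 2) : ℝ) * u.2 0)
      (x.1.val ^ (-(1 / 2) : ℝ) • (x.2.val.val *ᵥ Fin.tail u.2)))

/-- Push-forward of parallel one-forms under `(X⁰, X) ↦ (X⁰, X + X⁰ b)`. -/
def pushTr (S : PSR m) (b : Fin m → ℝ) (u : Par m) : Par m :=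
  (Fin.cons (u.1 0 - Fin.tail u.1 ⬝ᵥ b + (u.2 0 / 6) * (contr S.k b b ⬝ᵥ b)
        + (1 / 2) * (contr S.k b b ⬝ᵥ Fin.tail u.2))
      (Fin.tail u.1 - (u.2 0 / 2) • contr S.k b b - contr S.k b (Fin.tail u.2)),
   Fin.cons (u.2 0) (Fin.tail u.2 + u.2 0 • b))

/-- Push-forward of parallel one-forms under an element of `Aff_H(ℝⁿ⁻¹)`. -/
def push (S : PSR m) (g : AffH S) (u : Par m) : Par m :=
  pushTr S g.left.toAdd (pushLin S g.right u)

theorem sympl_eq (u v : Par m) : sympl u v = u.1 0 * v.2 0 - u.2 0 * v.1 0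
    + (Fin.tail u.1 ⬝ᵥ Fin.tail v.2 - Fin.tail u.2 ⬝ᵥ Fin.tail v.1) := by
  simp only [sympl, dotProduct, Fin.sum_univ_succ, Fin.tail]; ring

theorem par_ext {u v : Par m} (h1 : u.1 0 = v.1 0) (h2 : Fin.tail u.1 = Fin.tail v.1)
    (h3 : u.2 0 = v.2 0) (h4 : Fin.tail u.2 = Fin.tail v.2) : u = v := by
  refine Prod.ext ?_ ?_
  · rw [← Fin.cons_self_tail u.1, ← Fin.cons_self_tail v.1, h1, h2]
  · rw [← Fin.cons_self_tail u.2, ← Fin.cons_self_tail v.2, h3, h4]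

theorem tail_add (u v : Fin (m + 1) → ℝ) : Fin.tail (u + v) = Fin.tail u + Fin.tail v := rfl

theorem pushLin_add (S : PSR m) (x : PosReal × autH S) (u v : Par m) :
    pushLin S x (u + v) = pushLin S x u + pushLin S x v := by
  refine par_ext ?_ ?_ ?_ ?_ <;>
    simp [pushLin, tail_add, Matrix.mulVec_add, mul_add]

theorem pushLin_one (S : PSR m) (u : Par m) : pushLin S 1 u = u := by
  refine par_ext ?_ ?_ ?_ ?_ <;> simp [pushLin]

theorem pushLin_mul (S : PSR m) (x y : PosReal × autH S) (u : Par m) :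
    pushLin S (x * y) u = pushLin S x (pushLin S y u) := by
  have h := fun p => Real.mul_rpow (z := p) x.1.2.le y.1.2.le
  refine par_ext ?_ ?_ ?_ ?_ <;>
    simp [pushLin, h, mul_assoc, Matrix.mulVec_smul, smul_smul, Matrix.mulVec_mulVec]

theorem pushLin_sympl (S : PSR m) (x : PosReal × autH S) (u v : Par m) :
    sympl (pushLin S x u) (pushLin S x v) = sympl u v := by
  have h1 : x.1.val ^ (-(3 / 2) : ℝ) * x.1.val ^ (3 / 2 : ℝ) = 1 := by
    rw [← Real.rpow_add x.1.2]; simp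
  have h2 : x.1.val ^ (-(1 / 2) : ℝ) * x.1.val ^ (1 / 2 : ℝ) = 1 := by
    rw [← Real.rpow_add x.1.2]; simp
  have h3 := dot_autH x.2.val (Fin.tail u.1) (Fin.tail v.2)
  have h4 := dot_autH x.2.val (Fin.tail v.1) (Fin.tail u.2)
  rw [sympl_eq, sympl_eq]
  simp only [pushLin, Fin.cons_zero, Fin.tail_cons, smul_dotProduct, dotProduct_smul, smul_eq_mul]
  rw [h3, dotProduct_comm _ (_ *ᵥ Fin.tail v.1), h4, dotProduct_comm (Fin.tail u.2)]
  linear_combination (u.1 0 * v.2 0 - u.2 0 * v.1 0) * h1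
    + (Fin.tail u.1 ⬝ᵥ Fin.tail v.2 - Fin.tail v.1 ⬝ᵥ Fin.tail u.2) * h2

theorem pushTr_add (S : PSR m) (b : Fin m → ℝ) (u v : Par m) :
    pushTr S b (u + v) = pushTr S b u + pushTr S b v := by
  refine par_ext ?_ ?_ ?_ ?_ <;>
    simp only [pushTr, tail_add, contr_add_right, add_dotProduct, dotProduct_add, Prod.fst_add,
      Prod.snd_add, Pi.add_apply, Fin.cons_zero, Fin.tail_cons, add_smul, add_div]
  · ring
  · abel
  · abel

theorem pushTr_zero (S : PSR m) (u : Par m) : pushTr S 0 u = u := by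
  have h : ∀ v, contr S.k 0 v = 0 := fun v => by
    simpa using contr_smul_left S 0 v 0
  refine par_ext ?_ ?_ ?_ ?_ <;> simp [pushTr, h]

theorem pushTr_comp (S : PSR m) (b c : Fin m → ℝ) (u : Par m) :
    pushTr S (b + c) u = pushTr S b (pushTr S c u) := by
  have p := tri_swap_left S
  have q := tri_swap_right S
  refine par_ext ?_ ?_ ?_ ?_
  · simp only [pushTr, Fin.cons_zero, Fin.tail_cons, contr_dot, sub_dotProduct, smul_dotProduct,
      dotProduct_add, tri_add_left, tri_add_mid, tri_smul_right, smul_eq_mul]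
    rw [p c b b, q b c b, p c b c, q c c b, p c b c, p c b (Fin.tail u.2),
      q c (Fin.tail u.2) b, p c b (Fin.tail u.2)]
    ring
  · simp only [pushTr, Fin.cons_zero, Fin.tail_cons, contr_add_left, contr_add_right,
      contr_smul_right, contr_comm S c b]
    module
  · simp [pushTr]
  · simp only [pushTr, Fin.cons_zero, Fin.tail_cons]
    module

theorem pushTr_sympl (S : PSR m) (b : Fin m → ℝ) (u v : Par m) :
    sympl (pushTr S b u) (pushTr S b v) = sympl u v := by
  rw [sympl_eq, sympl_eq]
  simp only [pushTr, Fin.cons_zero, Fin.tail_cons, contr_dot, sub_dotProduct, smul_dotProduct,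
    dotProduct_add, add_dotProduct, dotProduct_sub, dotProduct_smul, smul_eq_mul]
  rw [dotProduct_comm (Fin.tail u.2) (contr _ _ _), dotProduct_comm (Fin.tail u.2) (contr _ _ _),
    dotProduct_comm b (contr _ _ _), dotProduct_comm b (contr _ _ _),
    dotProduct_comm b (Fin.tail v.1)]
  simp only [contr_dot]
  rw [tri_swap_right S b (Fin.tail v.2) (Fin.tail u.2), tri_swap_right S b (Fin.tail u.2) b,
    tri_swap_right S b (Fin.tail v.2) b]
  ring

theorem pushLin_pushTr (S : PSR m) (x : PosReal × autH S) (b : Fin m → ℝ) (u : Par m) :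
    pushLin S x (pushTr S b u) = pushTr S (linAct S x b) (pushLin S x u) := by
  obtain ⟨s, hs, hsx⟩ : ∃ s : ℝ, 0 < s ∧ s ^ 2 = x.1.val :=
    ⟨x.1.val.sqrt, Real.sqrt_pos.2 x.1.2, Real.sq_sqrt x.1.2.le⟩
  have r1 : x.1.val ^ (1 / 2 : ℝ) = s := by
    rw [← hsx, ← Real.rpow_natCast, ← Real.rpow_mul hs.le]; norm_num
  have r2 : x.1.val ^ (3 / 2 : ℝ) = s ^ 3 := by
    rw [← hsx, ← Real.rpow_natCast, ← Real.rpow_natCast, ← Real.rpow_mul hs.le]; norm_num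
  have r3 : x.1.val ^ (-(1 / 2) : ℝ) = s⁻¹ := by rw [Real.rpow_neg x.1.2.le, r1]
  have r4 : x.1.val ^ (-(3 / 2) : ℝ) = (s ^ 3)⁻¹ := by rw [Real.rpow_neg x.1.2.le, r2]
  refine par_ext ?_ ?_ ?_ ?_ <;>
    simp only [pushLin, pushTr, linAct, r1, r2, r3, r4, Fin.cons_zero, Fin.tail_cons,
      contr_smul_left, contr_smul_right, smul_dotProduct, dotProduct_smul, contr_autH, dot_autH,
      Matrix.mulVec_add, Matrix.mulVec_sub, Matrix.mulVec_smul, smul_eq_mul, smul_add, smul_sub,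
      smul_smul] <;>
    simp only [← hsx]
  · field_simp
  · congr 2
    · congr 1; field_simp
    · field_simp
  · congr 2; field_simp

theorem push_mul (S : PSR m) (g g' : AffH S) (u : Par m) :
    push S (g * g') u = push S g (push S g' u) := by
  simp only [push, SemidirectProduct.mul_left, SemidirectProduct.mul_right, toAdd_mul,
    pushTr_comp, pushLin_mul, pushLin_pushTr]
  rfl

theorem push_one (S : PSR m) (u : Par m) : push S 1 u = u := by
  simp [push, pushTr_zero, pushLin_one]

theorem push_add (S : PSR m) (g : AffH S) (u v : Par m) :
    push S g (u + v) = push S g u + push S g v := by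
  simp only [push, pushLin_add, pushTr_add]

theorem push_sympl (S : PSR m) (g : AffH S) (u v : Par m) :
    sympl (push S g u) (push S g v) = sympl u v := by
  simp only [push, pushTr_sympl, pushLin_sympl]

theorem push_zero (S : PSR m) (g : AffH S) : push S g 0 = 0 := by
  simpa using push_add S g 0 0

/-- The automorphism `(α, τ) ↦ (g_* α, τ)` of the Heisenberg group. -/
def heisAut (S : PSR m) (g : AffH S) : Heis m ≃* Heis m where
  toFun x := ⟨push S g x.form, x.ctr⟩
  invFun x := ⟨push S g⁻¹ x.form, x.ctr⟩
  left_inv x := by simp [← push_mul, push_one]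
  right_inv x := by simp [← push_mul, push_one]
  map_mul' x y := by ext1 <;> simp [push_add, push_sympl]

theorem heisAut_cyc (S : PSR m) (g : AffH S) :
    (cyc m).map (heisAut S g : Heis m →* Heis m) = cyc m := by
  rw [cyc, MonoidHom.map_zpowers]
  congr 1
  ext1
  · exact push_zero S g
  · rfl

/-- The induced action of `Aff_H` on `Heis_{2n+1}/F` by automorphisms. -/
def heisHom (S : PSR m) : AffH S →* MulAut (Heis m ⧸ cyc m) where
  toFun g := QuotientGroup.congr (cyc m) (cyc m) (heisAut S g) (heisAut_cyc S g)
  map_one' := by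
    ext x
    induction x using QuotientGroup.induction_on with
    | H x =>
      show ((heisAut S 1 x : Heis m) : Heis m ⧸ cyc m) = x
      congr 1
      ext1
      · exact push_one S _
      · rfl
  map_mul' g g' := by
    ext x
    induction x using QuotientGroup.induction_on with
    | H x =>
      show ((heisAut S (g * g') x : Heis m) : Heis m ⧸ cyc m)
        = ((heisAut S g (heisAut S g' x) : Heis m) : Heis m ⧸ cyc m)
      congr 1
      ext1
      · exact push_mul S _ _ _
      · rfl

/-- The group `Aff_H(ℝⁿ⁻¹) ⋉ (Heis_{2n+1}/F)`. -/
abbrev SymGroup (S : PSR m) : Type :=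
  (Heis m ⧸ cyc m) ⋊[heisHom S] AffH S

/-! ### The conical affine special Kähler manifold `M ⊆ ℂⁿ`, `n = m + 1` -/

/-- `ℂⁿ` with `n = m + 1`; it is also the real tangent space of `M` at each of its points. -/
abbrev CVec (m : ℕ) : Type := Fin (m + 1) → ℂ

/-- Real covectors on `ℂⁿ`, i.e. elements of `T*_X M`. -/
abbrev Cov (m : ℕ) : Type := CVec m →L[ℝ] ℝ

/-- The cone `U = ℝ_{>0} · H`. -/
def cone (S : PSR m) : Set (Fin m → ℝ) :=
  {t | ∃ r : ℝ, 0 < r ∧ ∃ y ∈ S.H, t = r • y}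

/-- `M = {X⁰ · (1, z) | X⁰ ∈ ℂ*, z ∈ ℝⁿ⁻¹ + i U}`. -/
def caskM (S : PSR m) : Set (CVec m) :=
  {X | ∃ z : Fin m → ℂ, (fun a => (z a).im) ∈ cone S ∧ X 0 ≠ 0 ∧ ∀ a, X a.succ = X 0 * z a}

/-- The holomorphic prepotential `𝔉(X) = -(1/6) k_{abc} X^a X^b X^c / X⁰`. -/
def prepot (S : PSR m) (X : CVec m) : ℂ :=
  -(1 / 6) * (∑ a, ∑ b, ∑ c, (S.k a b c : ℂ) * X a.succ * X b.succ * X c.succ) / X 0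

/-- `∂𝔉/∂Xⁱ`. -/
def prepotD (S : PSR m) (i : Fin (m + 1)) (X : CVec m) : ℂ :=
  fderiv ℂ (prepot S) X (Pi.single i 1)

/-- `τᵢⱼ = ∂²𝔉/∂Xⁱ∂Xʲ`. -/
def tau (S : PSR m) (X : CVec m) (i j : Fin (m + 1)) : ℂ :=
  fderiv ℂ (prepotD S j) X (Pi.single i 1)

/-- `dxⁱ = Re dXⁱ`. -/
def dRe (i : Fin (m + 1)) : Cov m :=
  Complex.reCLM ∘L (ContinuousLinearMap.proj i : CVec m →L[ℝ] ℂ)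

/-- `Im dXⁱ`. -/
def dIm (i : Fin (m + 1)) : Cov m :=
  Complex.imCLM ∘L (ContinuousLinearMap.proj i : CVec m →L[ℝ] ℂ)

/-- `dyᵢ = -Re d(∂𝔉/∂Xⁱ)` at `X`. -/
def dY (S : PSR m) (i : Fin (m + 1)) (X : CVec m) : Cov m :=
  fderiv ℝ (fun Y => -(prepotD S i Y).re) X

/-- The metric `g = Im(τᵢⱼ) dXⁱ dX̄ʲ` at `X`, as the map `u ↦ g(u, ·)`; thus
`g(u, v) = ∑ Im(τᵢⱼ) Re(uⁱ v̄ʲ)`. -/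
def metM (S : PSR m) (X : CVec m) : CVec m →L[ℝ] Cov m :=
  ∑ i, ∑ j, (tau S X i j).im • ((dRe i).smulRight (dRe j) + (dIm i).smulRight (dIm j))

/-- The complex structure `J` of `M`, multiplication by `i`. -/
def cplx (m : ℕ) : CVec m →L[ℝ] CVec m :=
  Complex.I • ContinuousLinearMap.id ℝ (CVec m)

/-- The Kähler form `ω = g(J ·, ·) = (i/2) Im(τᵢⱼ) dXⁱ ∧ dX̄ʲ` at `X`, as the map `u ↦ ω(u, ·)`. -/
def omM (S : PSR m) (X : CVec m) : CVec m →L[ℝ] Cov m :=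
  metM S X ∘L cplx m

/-- The metric `g⁻¹` on covectors. -/
def metInv (S : PSR m) (X : CVec m) (α β : Cov m) : ℝ :=
  β ((metM S X).inverse α)

/-- `ω⁻¹ : T*_X M → T_X M`, the inverse of `u ↦ ω(u, ·)`. -/
def omSharp (S : PSR m) (X : CVec m) : Cov m →L[ℝ] CVec m :=
  (omM S X).inverse

/-- The symplectic form on covectors corresponding to `ω` under `ω⁻¹ : T*_X M ≅ T_X M`. -/
def omInv (S : PSR m) (X : CVec m) (α β : Cov m) : ℝ :=
  omM S X (omSharp S X α) (omSharp S X β)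

/-- The global `∇`-parallel frame of `T*M`: the covector `∑ aᵢ dxⁱ + ∑ a'ⁱ dyᵢ` at `X`. -/
def frame (S : PSR m) (X : CVec m) : Par m →L[ℝ] Cov m :=
  ∑ i, (((ContinuousLinearMap.proj i : (Fin (m + 1) → ℝ) →L[ℝ] ℝ) ∘L
      ContinuousLinearMap.fst ℝ _ _).smulRight (dRe i)
    + ((ContinuousLinearMap.proj i : (Fin (m + 1) → ℝ) →L[ℝ] ℝ) ∘L
      ContinuousLinearMap.snd ℝ _ _).smulRight (dY S i X))

/-! ### The rigid c-map structure on `N = T*M`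

Points of `N` are pairs `(X, β)` with `X ∈ M` and `β` a covector at `X`.  The flat connection `∇`
splits `T_{(X,β)} N = T_X M ⊕ T*_X M`; tensors on `N` are written in this splitting. -/

/-- Elements of `T_X M ⊕ T*_X M`. -/
abbrev Split (m : ℕ) : Type := CVec m × Cov m

/-- The vertical part `(π*∇)_A λ` of a tangent vector `A` of `T*M` at `y = (X, β)`, where `λ` is the
tautological section: differentiate the coefficients of `β` in the parallel frame. -/
def vert (S : PSR m) (y A : CVec m × Cov m) : Cov m :=
  frame S y.1 (fderiv ℝ (fun y' : CVec m × Cov m => (frame S y'.1).inverse y'.2) y A)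

/-- The isomorphism `T_y N ≅ T_X M ⊕ T*_X M` given by `∇`. -/
def split (S : PSR m) (y A : CVec m × Cov m) : Split m := (A.1, vert S y A)

/-- `g_N = diag(g, g⁻¹)`. -/
def metN (S : PSR m) (X : CVec m) (A B : Split m) : ℝ :=
  metM S X A.1 B.1 + metInv S X A.2 B.2

/-- `I₁ = diag(J, J*)`. -/
def cplx1 (A : Split m) : Split m := (cplx m A.1, A.2 ∘L cplx m)

/-- `I₂ (v, γ) = (-ω⁻¹ γ, ω v)`. -/
def cplx2 (S : PSR m) (X : CVec m) (A : Split m) : Split m := (-omSharp S X A.2, omM S X A.1)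

/-- `I₃ = I₁ I₂`. -/
def cplx3 (S : PSR m) (X : CVec m) (A : Split m) : Split m := cplx1 (cplx2 S X A)

/-- The rotating vector field `Z`, the `∇`-horizontal lift of `-Jξ`, where `ξ_X = X`. -/
def rotZ (X : CVec m) : Split m := (-cplx m X, 0)

/-- The one-form on `M` whose pull-back to `N` is `ι_Z g_N`. -/
def zForm (S : PSR m) (X : CVec m) : Cov m := metM S X (-cplx m X)

/-- `ω_H = ω₁ + d(ι_Z g_N)`, with `ω₁ = g_N(I₁ ·, ·)` and `dθ(u,v) = (D_u θ)(v) - (D_v θ)(u)`. -/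
def omH (S : PSR m) (X : CVec m) (A B : Split m) : ℝ :=
  metN S X (cplx1 A) B
    + (fderiv ℝ (zForm S) X A.1 B.1 - fderiv ℝ (zForm S) X B.1 A.1)

/-- `f_Z^c = -(1/2) g_N(Z,Z) - c/2`. -/
def fZ (S : PSR m) (c : ℝ) (X : CVec m) : ℝ := -(1 / 2) * metN S X (rotZ X) (rotZ X) - c / 2

/-- `f_H^c = f_Z^c + g_N(Z,Z)`. -/
def fH (S : PSR m) (c : ℝ) (X : CVec m) : ℝ := fZ S c X + metN S X (rotZ X) (rotZ X)

/-! ### The circle bundle `P = N × S¹` and the one-loop deformed q-map space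

The circle `ℝ/2πℤ` is the unit circle of `ℂ` via `s ↦ exp(is)`, so that `P` consists of triples
`(X, β, w)` with `|w| = 1`. -/

/-- The vector space containing `P`. -/
abbrev Amb (m : ℕ) : Type := CVec m × Cov m × ℂ

/-- The split horizontal and vertical parts of the projection to `N` of a tangent vector of `P`. -/
def toSplit (S : PSR m) (p A : Amb m) : Split m := split S (p.1, p.2.1) (A.1, A.2.1)

/-- The connection `η = ds + (1/2) ι_Ξ ω_H`, where `Ξ` is the sum of the horizontal lift of `ξ` and
the fibrewise Euler field. -/
def eta (S : PSR m) (p A : Amb m) : ℝ :=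
  (conj p.2.2 * A.2.2).im + (1 / 2) * omH S p.1 (p.1, p.2.1) (toSplit S p A)

/-- `θ₀ = d f_Z^c`. -/
def theta0 (S : PSR m) (c : ℝ) (p A : Amb m) : ℝ := fderiv ℝ (fZ S c) p.1 A.1

/-- `θ₁ = η - ι_Z g_N`. -/
def theta1 (S : PSR m) (p A : Amb m) : ℝ := eta S p A - metN S p.1 (rotZ p.1) (toSplit S p A)

/-- `θ₂ = -ι_Z ω₃`. -/
def theta2 (S : PSR m) (p A : Amb m) : ℝ :=
  -metN S p.1 (cplx3 S p.1 (rotZ p.1)) (toSplit S p A)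

/-- `θ₃ = ι_Z ω₂`. -/
def theta3 (S : PSR m) (p A : Amb m) : ℝ :=
  metN S p.1 (cplx2 S p.1 (rotZ p.1)) (toSplit S p A)

/-- `g_P = -(1/f_H^c) η² + g_N`. -/
def metP (S : PSR m) (c : ℝ) (p A B : Amb m) : ℝ :=
  -(1 / fH S c p.1) * (eta S p A * eta S p B) + metN S p.1 (toSplit S p A) (toSplit S p B)

/-- `g^c = (1 / (4 |f_Z^c|)) (g_P + (1/f_Z^c) ∑ θⱼ²)`. -/
def metQ (S : PSR m) (c : ℝ) (p A B : Amb m) : ℝ :=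
  1 / (4 * |fZ S c p.1|) * (metP S c p A B + 1 / fZ S c p.1 *
    (theta0 S c p A * theta0 S c p B + theta1 S p A * theta1 S p B
      + theta2 S p A * theta2 S p B + theta3 S p A * theta3 S p B))

/-- The deformed q-map space `N̄ = {arg X⁰ = 0} ⊆ P`, on the region `f_Z^c > 0`. -/
def Nbar (S : PSR m) (c : ℝ) : Set (Amb m) :=
  {p | p.1 ∈ caskM S ∧ ‖p.2.2‖ = 1 ∧ (p.1 0).arg = 0 ∧ 0 < fZ S c p.1}

/-- The tangent space of `N̄` at `p`: `N̄` is open in `{Im X⁰ = 0, |w| = 1}`. -/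
def tangentNbar (p : Amb m) : Set (Amb m) :=
  {A | (A.1 0).im = 0 ∧ (conj p.2.2 * A.2.2).re = 0}

/-- `F` is a smooth extension of the self-map `f` of `N̄` to a neighbourhood of `N̄`. -/
def SmoothExt (S : PSR m) (c : ℝ) (f : Nbar S c → Nbar S c) (F : Amb m → Amb m) : Prop :=
  ∀ x : Nbar S c, F x.1 = (f x).1 ∧ ContDiffAt ℝ ∞ F x.1

/-- `f` is a diffeomorphism of `N̄` preserving the metric `g^c`. -/
def IsIsometryNbar (S : PSR m) (c : ℝ) (f : Nbar S c ≃ Nbar S c) : Prop :=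
  (∃ F, SmoothExt S c f.symm F) ∧
  ∃ F, SmoothExt S c f F ∧ ∀ x : Nbar S c, ∀ A ∈ tangentNbar x.1, ∀ B ∈ tangentNbar x.1,
    metQ S c (f x).1 (fderiv ℝ F x.1 A) (fderiv ℝ F x.1 B) = metQ S c x.1 A B

/-! ### The action on `P` -/

/-- The action of `(b, r, A) ∈ Aff_H(ℝⁿ⁻¹)` on `M`:
`(X⁰, X) ↦ (r^{-3/2} X⁰, r^{-1/2} A X + r^{-3/2} X⁰ b)`, which covers `z ↦ r A z + b`. -/
def affM (S : PSR m) (g : AffH S) (X : CVec m) : CVec m :=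
  Fin.cons ((g.right.1.val ^ (-(3 / 2) : ℝ) : ℝ) * X 0)
    (fun a => (g.right.1.val ^ (-(1 / 2) : ℝ) : ℝ) * ∑ b, (g.right.2.val.val a b : ℂ) * X b.succ
      + (g.right.1.val ^ (-(3 / 2) : ℝ) : ℝ) * X 0 * (g.left.toAdd a : ℂ))

/-- `g · (β, s) = (g_* β, s)` with `g_* β = (g⁻¹)^* β`. -/
def affP (S : PSR m) (g : AffH S) (p : Amb m) : Amb m :=
  (affM S g p.1, p.2.1 ∘L fderiv ℝ (affM S g⁻¹) (affM S g p.1), p.2.2)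

/-- `(α, τ) · (β, s) = (α(X) + β, s + [τ + (1/2) ω⁻¹(α(X), β)])`. -/
def heisP (S : PSR m) (x : Heis m) (p : Amb m) : Amb m :=
  (p.1, frame S p.1 x.form + p.2.1,
    p.2.2 * Complex.exp (Complex.I *
      ((x.ctr + (1 / 2) * omInv S p.1 (frame S p.1 x.form) p.2.1 : ℝ) : ℂ)))

end

end QMap

/-! The metric `metQ` is built by natural operations from data on `M`: the metric `metM`, the
complex structure, the flat connection (through its parallel frame) and the Euler field. A
transformation of `P` that respects these data and the one-form `η` is therefore an isometry, and
two families of transformations have to be examined.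

The group `Aff_H` acts on `ℂⁿ` by complex linear maps, which commute with `J` and fix the Euler
field. The linear part preserves the Hessian of the prepotential exactly, because `Aut(H)` preserves
the cubic (`tri_autH`) and the powers of `r` cancel (`hess_linM`). A translation by `b` changes the
Hessian by a form with real coefficients (`hess_trM`), which the imaginary part does not see. Hence
the metric is invariant (`metM_affM`). The real parts show that the parallel frame goes to itself up
to the constant matrix `push` (`frame_affM`), so the splitting of `TN` is preserved as well
(`vert_affM`). All remaining tensors follow, which gives `metQ_affA`.

A Heisenberg element adds a parallel one-form to `β`. The coefficients of `β` shift by a constant,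
so the split components of tangent vectors do not change (`toSplit_heisA`). The field `Ξ` does
change, since its vertical part is `β`; this alters `½ ι_Ξ ω_H` by `-½ ω⁻¹(α, ·)`, and the
derivative of the phase by which the circle is rotated compensates exactly (`eta_heisA`). That `ω⁻¹`
is the standard symplectic form on parallel coefficients (`omInv_frame`) makes the phase the
Heisenberg cocycle (`heisA_mul`).

The action is effective because an element fixing the points `(r(1, x + it), 0, 1)` for all real `x`
acts trivially on `M`, then has zero one-form, then has central part in `2πℤ`. -/

namespace QMap

noncomputable section

variable {m : ℕ}

/-! ### The complexified trilinear form -/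

/-- The complex trilinear extension of `tri`. -/
def ctri (k : Fin m → Fin m → Fin m → ℝ) (u v w : Fin m → ℂ) : ℂ :=
  ∑ a, ∑ b, ∑ c, (k a b c : ℂ) * u a * v b * w c

/-- The inclusion of real vectors into complex vectors. -/
def cv {ι : Type*} (u : ι → ℝ) : ι → ℂ := fun i => (u i : ℂ)

/-- The real part of a complex vector. -/
def rv {ι : Type*} (u : ι → ℂ) : ι → ℝ := fun i => (u i).re

/-- The imaginary part of a complex vector. -/
def iv {ι : Type*} (u : ι → ℂ) : ι → ℝ := fun i => (u i).im

theorem cv_rv_add {ι : Type*} (u : ι → ℂ) : cv (rv u) + Complex.I • cv (iv u) = u := by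
  ext i; simp [cv, rv, iv, mul_comm Complex.I, Complex.re_add_im]

theorem ctri_swap_left (S : PSR m) (u v w : Fin m → ℂ) : ctri S.k u v w = ctri S.k v u w := by
  simp only [ctri]
  rw [Finset.sum_comm]
  refine Finset.sum_congr rfl fun a _ => Finset.sum_congr rfl fun b _ =>
    Finset.sum_congr rfl fun c _ => ?_
  rw [S.symm_left b a c]; ring

theorem ctri_swap_right (S : PSR m) (u v w : Fin m → ℂ) : ctri S.k u v w = ctri S.k u w v := by
  simp only [ctri]
  refine Finset.sum_congr rfl fun a _ => ?_
  rw [Finset.sum_comm]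
  refine Finset.sum_congr rfl fun b _ => Finset.sum_congr rfl fun c _ => ?_
  rw [S.symm_right a c b]; ring

theorem ctri_add_right (k : Fin m → Fin m → Fin m → ℝ) (u v w w' : Fin m → ℂ) :
    ctri k u v (w + w') = ctri k u v w + ctri k u v w' := by
  simp only [ctri, Pi.add_apply, mul_add, Finset.sum_add_distrib]

theorem ctri_smul_right (k : Fin m → Fin m → Fin m → ℝ) (u v w : Fin m → ℂ) (r : ℂ) :
    ctri k u v (r • w) = r * ctri k u v w := by
  simp only [ctri, Pi.smul_apply, smul_eq_mul, Finset.mul_sum]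
  refine Finset.sum_congr rfl fun a _ => Finset.sum_congr rfl fun b _ =>
    Finset.sum_congr rfl fun c _ => ?_
  ring

theorem ctri_add_mid (S : PSR m) (u v v' w : Fin m → ℂ) :
    ctri S.k u (v + v') w = ctri S.k u v w + ctri S.k u v' w := by
  rw [ctri_swap_right, ctri_add_right, ctri_swap_right S u v, ctri_swap_right S u v']

theorem ctri_smul_mid (S : PSR m) (u v w : Fin m → ℂ) (r : ℂ) :
    ctri S.k u (r • v) w = r * ctri S.k u v w := by
  rw [ctri_swap_right, ctri_smul_right, ctri_swap_right S u v]

theorem ctri_add_left (S : PSR m) (u u' v w : Fin m → ℂ) :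
    ctri S.k (u + u') v w = ctri S.k u v w + ctri S.k u' v w := by
  rw [ctri_swap_left, ctri_add_mid, ctri_swap_left S u v, ctri_swap_left S u' v]

theorem ctri_smul_left (S : PSR m) (u v w : Fin m → ℂ) (r : ℂ) :
    ctri S.k (r • u) v w = r * ctri S.k u v w := by
  rw [ctri_swap_left, ctri_smul_mid, ctri_swap_left S u v]

theorem ctri_cv (k : Fin m → Fin m → Fin m → ℝ) (u v w : Fin m → ℝ) :
    ctri k (cv u) (cv v) (cv w) = (tri k u v w : ℂ) := by
  simp [ctri, tri, cv]

/-- The complex-linear extension of an element of `GL(m, ℝ)`. -/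
def cAct (A : GL (Fin m) ℝ) (u : Fin m → ℂ) : Fin m → ℂ :=
  fun a => ∑ b, (A.val a b : ℂ) * u b

theorem cAct_add (A : GL (Fin m) ℝ) (u v : Fin m → ℂ) : cAct A (u + v) = cAct A u + cAct A v := by
  ext a; simp [cAct, mul_add, Finset.sum_add_distrib]

theorem cAct_smul (A : GL (Fin m) ℝ) (r : ℂ) (u : Fin m → ℂ) :
    cAct A (r • u) = r • cAct A u := by
  ext a
  simp only [cAct, Pi.smul_apply, smul_eq_mul, Finset.mul_sum]
  exact Finset.sum_congr rfl fun b _ => by ring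

theorem cAct_cv (A : GL (Fin m) ℝ) (u : Fin m → ℝ) : cAct A (cv u) = cv (A.val *ᵥ u) := by
  ext a; simp [cAct, cv, Matrix.mulVec, dotProduct]

theorem cAct_one (u : Fin m → ℂ) : cAct 1 u = u := by
  rw [← cv_rv_add u]
  simp only [cAct_add, cAct_smul, cAct_cv, Units.val_one, Matrix.one_mulVec]

theorem cAct_mul (A B : GL (Fin m) ℝ) (u : Fin m → ℂ) : cAct (A * B) u = cAct A (cAct B u) := by
  rw [← cv_rv_add u]
  simp only [cAct_add, cAct_smul, cAct_cv, Units.val_mul, Matrix.mulVec_mulVec]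

/-- An element of `Aut(H)` preserves the complexified trilinear form. -/
theorem ctri_autH (S : PSR m) (A : autH S) (u v w : Fin m → ℂ) :
    ctri S.k (cAct A.val u) (cAct A.val v) (cAct A.val w) = ctri S.k u v w := by
  rw [← cv_rv_add u, ← cv_rv_add v, ← cv_rv_add w]
  simp only [cAct_add, cAct_smul, cAct_cv, ctri_add_left, ctri_add_mid, ctri_add_right,
    ctri_smul_left, ctri_smul_mid, ctri_smul_right, ctri_cv, tri_autH]

/-! ### The Hessian of the prepotential -/

/-- The inhomogeneous coordinate `z = X/X⁰`. -/
def zc (X : CVec m) : Fin m → ℂ := (X 0)⁻¹ • Fin.tail X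

/-- The Hessian of the prepotential in terms of the inhomogeneous coordinate `z`. -/
def hess (S : PSR m) (z : Fin m → ℂ) (u v : CVec m) : ℂ :=
  -ctri S.k z (Fin.tail u) (Fin.tail v) + 1 / 2 * ctri S.k z z (Fin.tail u) * v 0
    + 1 / 2 * ctri S.k z z (Fin.tail v) * u 0 - 1 / 3 * ctri S.k z z z * u 0 * v 0

theorem ctail_add (u v : CVec m) : Fin.tail (u + v) = Fin.tail u + Fin.tail v := rfl

theorem ctail_smul (r : ℂ) (u : CVec m) : Fin.tail (r • u) = r • Fin.tail u := rfl

theorem hess_symm (S : PSR m) (z : Fin m → ℂ) (u v : CVec m) : hess S z u v = hess S z v u := by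
  simp only [hess]
  rw [ctri_swap_right S z (Fin.tail u)]; ring

theorem hess_add_right (S : PSR m) (z : Fin m → ℂ) (u v w : CVec m) :
    hess S z u (v + w) = hess S z u v + hess S z u w := by
  simp only [hess, ctail_add, ctri_add_right, Pi.add_apply]; ring

theorem hess_smul_right (S : PSR m) (z : Fin m → ℂ) (u v : CVec m) (r : ℂ) :
    hess S z u (r • v) = r * hess S z u v := by
  simp only [hess, ctail_smul, ctri_smul_right, Pi.smul_apply, smul_eq_mul]; ring

theorem hess_add_left (S : PSR m) (z : Fin m → ℂ) (u v w : CVec m) :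
    hess S z (u + v) w = hess S z u w + hess S z v w := by
  rw [hess_symm, hess_add_right, hess_symm S z w, hess_symm S z w]

theorem hess_smul_left (S : PSR m) (z : Fin m → ℂ) (u v : CVec m) (r : ℂ) :
    hess S z (r • u) v = r * hess S z u v := by
  rw [hess_symm, hess_smul_right, hess_symm]

/-- The Hessian as a bilinear form. -/
def hessB (S : PSR m) (z : Fin m → ℂ) : CVec m →ₗ[ℂ] CVec m →ₗ[ℂ] ℂ :=
  LinearMap.mk₂ ℂ (hess S z) (fun u v w => hess_add_left S z u v w)
    (fun r u v => hess_smul_left S z u v r) (fun u v w => hess_add_right S z u v w)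
    (fun r u v => hess_smul_right S z u v r)

theorem hess_eq_sum_left (S : PSR m) (z : Fin m → ℂ) (u v : CVec m) :
    hess S z u v = ∑ i, u i * hess S z (Pi.single i 1) v := by
  have h := LinearMap.pi_apply_eq_sum_univ ((hessB S z).flip v) u
  simp only [LinearMap.flip_apply, hessB, LinearMap.mk₂_apply, smul_eq_mul] at h
  rw [h]
  refine Finset.sum_congr rfl fun i _ => ?_
  congr 2
  ext j; simp [Pi.single_apply, eq_comm]

theorem hess_eq_sum_right (S : PSR m) (z : Fin m → ℂ) (u v : CVec m) :
    hess S z u v = ∑ i, v i * hess S z u (Pi.single i 1) := by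
  rw [hess_symm, hess_eq_sum_left]
  exact Finset.sum_congr rfl fun i _ => by rw [hess_symm]

/-- The prepotential along a line. -/
theorem prepot_line (S : PSR m) (X v : CVec m) (t : ℂ) :
    prepot S (X + t • v) = -(1 / 6) * (ctri S.k (Fin.tail X) (Fin.tail X) (Fin.tail X)
      + t * (3 * ctri S.k (Fin.tail X) (Fin.tail X) (Fin.tail v))
      + t ^ 2 * (3 * ctri S.k (Fin.tail X) (Fin.tail v) (Fin.tail v))
      + t ^ 3 * ctri S.k (Fin.tail v) (Fin.tail v) (Fin.tail v)) / (X 0 + t * v 0) := by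
  have h : prepot S (X + t • v) = -(1 / 6) * ctri S.k (Fin.tail X + t • Fin.tail v)
      (Fin.tail X + t • Fin.tail v) (Fin.tail X + t • Fin.tail v) / (X 0 + t * v 0) := rfl
  rw [h]
  congr 2
  have p := ctri_swap_left S
  have q := ctri_swap_right S
  simp only [ctri_add_left, ctri_add_mid, ctri_add_right, ctri_smul_left, ctri_smul_mid,
    ctri_smul_right]
  rw [p (Fin.tail v) (Fin.tail X) (Fin.tail X), q (Fin.tail X) (Fin.tail v) (Fin.tail X),
    p (Fin.tail v) (Fin.tail X) (Fin.tail v), q (Fin.tail v) (Fin.tail v) (Fin.tail X),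
    p (Fin.tail v) (Fin.tail X) (Fin.tail v)]
  ring

/-- The differential of the prepotential. -/
def prepotGrad (S : PSR m) (X v : CVec m) : ℂ :=
  -(1 / 2) * ctri S.k (Fin.tail X) (Fin.tail X) (Fin.tail v) / X 0
    + (1 / 6) * ctri S.k (Fin.tail X) (Fin.tail X) (Fin.tail X) * v 0 / X 0 ^ 2

theorem prepot_differentiableAt (S : PSR m) {X : CVec m} (hX : X 0 ≠ 0) :
    DifferentiableAt ℂ (prepot S) X := by
  unfold prepot
  fun_prop (disch := exact hX)

/-- Differentiability allows the derivative to be computed along the line `X + t v`, where the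
prepotential is a cubic polynomial in `t` divided by an affine function; the one-variable quotient
rule finishes. -/
theorem fderiv_prepot (S : PSR m) {X : CVec m} (hX : X 0 ≠ 0) (v : CVec m) :
    fderiv ℂ (prepot S) X v = prepotGrad S X v := by
  rw [← (prepot_differentiableAt S hX).lineDeriv_eq_fderiv, lineDeriv]
  simp only [prepot_line]
  refine HasDerivAt.deriv ?_
  have h1 : HasDerivAt (fun t : ℂ => t) 1 0 := hasDerivAt_id 0
  have h2 := (((h1.mul_const (3 * ctri S.k (Fin.tail X) (Fin.tail X) (Fin.tail v))).const_add
    (ctri S.k (Fin.tail X) (Fin.tail X) (Fin.tail X))).fun_add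
    ((h1.fun_pow 2).mul_const (3 * ctri S.k (Fin.tail X) (Fin.tail v) (Fin.tail v)))).fun_add
    ((h1.fun_pow 3).mul_const (ctri S.k (Fin.tail v) (Fin.tail v) (Fin.tail v)))
  have h3 := (h1.mul_const (v 0)).const_add (X 0)
  have h4 := (h2.const_mul (-(1 / 6))).fun_div h3 (by simpa using hX)
  refine h4.congr_deriv ?_
  simp only [prepotGrad, zero_mul, add_zero]
  field_simp
  ring

theorem prepotGrad_line (S : PSR m) (X u v : CVec m) (t : ℂ) :
    prepotGrad S (X + t • v) u = -(1 / 2) * (ctri S.k (Fin.tail X) (Fin.tail X) (Fin.tail u)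
      + t * (2 * ctri S.k (Fin.tail X) (Fin.tail u) (Fin.tail v))
      + t ^ 2 * ctri S.k (Fin.tail v) (Fin.tail v) (Fin.tail u)) / (X 0 + t * v 0)
      + (1 / 6) * (ctri S.k (Fin.tail X) (Fin.tail X) (Fin.tail X)
      + t * (3 * ctri S.k (Fin.tail X) (Fin.tail X) (Fin.tail v))
      + t ^ 2 * (3 * ctri S.k (Fin.tail X) (Fin.tail v) (Fin.tail v))
      + t ^ 3 * ctri S.k (Fin.tail v) (Fin.tail v) (Fin.tail v)) * u 0 / (X 0 + t * v 0) ^ 2 := by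
  have h : (X + t • v) 0 = X 0 + t * v 0 := rfl
  have p := ctri_swap_left S
  have q := ctri_swap_right S
  simp only [prepotGrad, h, ctail_add, ctail_smul, ctri_add_left, ctri_add_mid, ctri_add_right,
    ctri_smul_left, ctri_smul_mid, ctri_smul_right]
  rw [p (Fin.tail v) (Fin.tail X) (Fin.tail X), q (Fin.tail X) (Fin.tail v) (Fin.tail X),
    p (Fin.tail v) (Fin.tail X) (Fin.tail v), q (Fin.tail v) (Fin.tail v) (Fin.tail X),
    p (Fin.tail v) (Fin.tail X) (Fin.tail v), p (Fin.tail v) (Fin.tail X) (Fin.tail u),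
    q (Fin.tail X) (Fin.tail v) (Fin.tail u)]
  ring

theorem prepotGrad_differentiableAt (S : PSR m) {X : CVec m} (hX : X 0 ≠ 0) (u : CVec m) :
    DifferentiableAt ℂ (fun Y => prepotGrad S Y u) X := by
  unfold prepotGrad ctri Fin.tail
  fun_prop (disch := first | exact hX | exact pow_ne_zero 2 hX)

/-- Same method. The prepotential is homogeneous of degree 2, so its second derivatives have degree
0 and depend on `X` only through `z = X/X⁰`. -/
theorem fderiv_prepotGrad (S : PSR m) {X : CVec m} (hX : X 0 ≠ 0) (u v : CVec m) :
    fderiv ℂ (fun Y => prepotGrad S Y u) X v = hess S (zc X) u v := by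
  rw [← (prepotGrad_differentiableAt S hX u).lineDeriv_eq_fderiv, lineDeriv]
  simp only [prepotGrad_line]
  refine HasDerivAt.deriv ?_
  have h1 : HasDerivAt (fun t : ℂ => t) 1 0 := hasDerivAt_id 0
  have h2 := (((h1.mul_const (3 * ctri S.k (Fin.tail X) (Fin.tail X) (Fin.tail v))).const_add
    (ctri S.k (Fin.tail X) (Fin.tail X) (Fin.tail X))).fun_add
    ((h1.fun_pow 2).mul_const (3 * ctri S.k (Fin.tail X) (Fin.tail v) (Fin.tail v)))).fun_add
    ((h1.fun_pow 3).mul_const (ctri S.k (Fin.tail v) (Fin.tail v) (Fin.tail v)))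
  have h2' := ((h1.mul_const (2 * ctri S.k (Fin.tail X) (Fin.tail u) (Fin.tail v))).const_add
    (ctri S.k (Fin.tail X) (Fin.tail X) (Fin.tail u))).fun_add
    ((h1.fun_pow 2).mul_const (ctri S.k (Fin.tail v) (Fin.tail v) (Fin.tail u)))
  have h3 := (h1.mul_const (v 0)).const_add (X 0)
  have h4 := ((h2'.const_mul (-(1 / 2))).fun_div h3 (by simpa using hX)).fun_add
    (((h2.const_mul (1 / 6)).mul_const (u 0)).fun_div (h3.fun_pow 2) (by simpa using hX))
  refine h4.congr_deriv ?_
  simp only [hess, zc, ctri_smul_left, ctri_smul_mid, ctri_smul_right, zero_mul, add_zero]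
  field_simp
  ring

theorem eventually_zero_ne {X : CVec m} (hX : X 0 ≠ 0) : ∀ᶠ Y : CVec m in nhds X, Y 0 ≠ 0 :=
  (continuous_apply 0).continuousAt.eventually_ne hX

theorem prepotD_eventuallyEq (S : PSR m) {X : CVec m} (hX : X 0 ≠ 0) (i : Fin (m + 1)) :
    prepotD S i =ᶠ[nhds X] fun Y => prepotGrad S Y (Pi.single i 1) := by
  filter_upwards [eventually_zero_ne hX] with Y hY
  exact fderiv_prepot S hY _

theorem prepotD_differentiableAt (S : PSR m) {X : CVec m} (hX : X 0 ≠ 0) (i : Fin (m + 1)) :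
    DifferentiableAt ℂ (prepotD S i) X :=
  (prepotGrad_differentiableAt S hX _).congr_of_eventuallyEq (prepotD_eventuallyEq S hX i)

theorem fderiv_prepotD (S : PSR m) {X : CVec m} (hX : X 0 ≠ 0) (i : Fin (m + 1)) (v : CVec m) :
    fderiv ℂ (prepotD S i) X v = hess S (zc X) (Pi.single i 1) v := by
  rw [(prepotD_eventuallyEq S hX i).fderiv_eq, fderiv_prepotGrad S hX]

theorem tau_eq (S : PSR m) {X : CVec m} (hX : X 0 ≠ 0) (i j : Fin (m + 1)) :
    tau S X i j = hess S (zc X) (Pi.single i 1) (Pi.single j 1) := by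
  rw [tau, fderiv_prepotD S hX, hess_symm]

theorem dY_apply (S : PSR m) {X : CVec m} (hX : X 0 ≠ 0) (i : Fin (m + 1)) (v : CVec m) :
    dY S i X v = -(hess S (zc X) (Pi.single i 1) v).re := by
  have h1 := ((prepotD_differentiableAt S hX i).hasFDerivAt.restrictScalars ℝ)
  have h2 := (Complex.reCLM.hasFDerivAt.comp X h1).neg
  have h3 : dY S i X = _ := h2.fderiv
  rw [h3, ← fderiv_prepotD S hX]
  simp

/-! ### The metric of `M` -/

/-- The imaginary part of the Hessian on real vectors. -/
def imHess (S : PSR m) (z : Fin m → ℂ) (a b : Fin (m + 1) → ℝ) : ℝ := (hess S z (cv a) (cv b)).im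

/-- Explicit formula for the imaginary part of the Hessian. -/
theorem imHess_eq (S : PSR m) (z : Fin m → ℂ) (a b : Fin (m + 1) → ℝ) :
    imHess S z a b = -tri S.k (iv z) (Fin.tail a - a 0 • rv z) (Fin.tail b - b 0 • rv z)
      + 1 / 3 * tri S.k (iv z) (iv z) (iv z) * a 0 * b 0 := by
  have ha : Fin.tail (cv a) = cv (Fin.tail a) := rfl
  have hb : Fin.tail (cv b) = cv (Fin.tail b) := rfl
  have ha0 : cv a 0 = (a 0 : ℂ) := rfl
  have hb0 : cv b 0 = (b 0 : ℂ) := rfl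
  have p := tri_swap_left S
  have q := tri_swap_right S
  rw [imHess, hess, ha, hb, ha0, hb0]
  generalize Fin.tail a = a', Fin.tail b = b'
  -- With `z = x + iy`, the imaginary part keeps the terms of odd degree in `y`. Those linear in `y`
  -- complete to a product of `a - a⁰x` and `b - b⁰x`, and only the `y³` term is left over.
  conv_lhs => rw [← cv_rv_add z]
  generalize rv z = x, iv z = y
  simp only [ctri_add_left, ctri_add_mid, ctri_add_right, ctri_smul_left, ctri_smul_mid,
    ctri_smul_right, ctri_cv, sub_eq_add_neg, ← neg_smul, tri_add_mid, tri_add_right, tri_smul_mid,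
    tri_smul_right]
  rw [p y x x, q x y x, p y x y, q x y y, q y y x, p y x y, q y a' x, p y x a', p y x b']
  simp [Complex.add_im, Complex.mul_im, Complex.mul_re]
  ring

theorem imHess_eq_sum (S : PSR m) (z : Fin m → ℂ) (a b : Fin (m + 1) → ℝ) :
    imHess S z a b
      = ∑ i, ∑ j, (hess S z (Pi.single i 1) (Pi.single j 1)).im * (a i * b j) := by
  rw [imHess, hess_eq_sum_left, Complex.im_sum]
  refine Finset.sum_congr rfl fun i _ => ?_
  rw [hess_eq_sum_right, Finset.mul_sum, Complex.im_sum]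
  refine Finset.sum_congr rfl fun j _ => ?_
  simp only [cv, Complex.im_ofReal_mul]
  ring

theorem imHess_symm (S : PSR m) (z : Fin m → ℂ) (a b : Fin (m + 1) → ℝ) :
    imHess S z a b = imHess S z b a := by
  rw [imHess, hess_symm, imHess]

theorem imHess_neg_left (S : PSR m) (z : Fin m → ℂ) (a b : Fin (m + 1) → ℝ) :
    imHess S z (-a) b = -imHess S z a b := by
  simp [imHess_eq_sum]

theorem imHess_neg_right (S : PSR m) (z : Fin m → ℂ) (a b : Fin (m + 1) → ℝ) :
    imHess S z a (-b) = -imHess S z a b := by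
  simp [imHess_eq_sum]

theorem imHess_zero_right (S : PSR m) (z : Fin m → ℂ) (a : Fin (m + 1) → ℝ) :
    imHess S z a 0 = 0 := by
  simp [imHess_eq_sum]

theorem imHess_zero_left (S : PSR m) (z : Fin m → ℂ) (a : Fin (m + 1) → ℝ) :
    imHess S z 0 a = 0 := by
  simp [imHess_eq_sum]

/-- Since `Re(uⁱ v̄ʲ)` is the product of the real parts plus the product of the imaginary parts, the
metric is two copies of the real form `Im τ`. -/
theorem metM_apply (S : PSR m) {X : CVec m} (hX : X 0 ≠ 0) (u v : CVec m) :
    metM S X u v = imHess S (zc X) (rv u) (rv v) + imHess S (zc X) (iv u) (iv v) := by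
  simp only [imHess_eq_sum, ← Finset.sum_add_distrib, metM, sum_apply]
  refine Finset.sum_congr rfl fun i _ => Finset.sum_congr rfl fun j _ => ?_
  rw [tau_eq S hX]
  simp [dRe, dIm, rv, iv]

theorem rv_cplx (u : CVec m) : rv (cplx m u) = -iv u := by
  ext i; simp [rv, iv, cplx]

theorem iv_cplx (u : CVec m) : iv (cplx m u) = rv u := by
  ext i; simp [rv, iv, cplx]

theorem metM_symm (S : PSR m) {X : CVec m} (hX : X 0 ≠ 0) (u v : CVec m) :
    metM S X u v = metM S X v u := by
  rw [metM_apply S hX, metM_apply S hX, imHess_symm, imHess_symm S _ (iv u)]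

theorem metM_cplx_cplx (S : PSR m) {X : CVec m} (hX : X 0 ≠ 0) (u v : CVec m) :
    metM S X (cplx m u) (cplx m v) = metM S X u v := by
  simp only [metM_apply S hX, rv_cplx, iv_cplx, imHess_neg_left, imHess_neg_right]
  ring

theorem cplx_cplx (u : CVec m) : cplx m (cplx m u) = -u := by
  simp [cplx, smul_smul]

theorem omM_apply (S : PSR m) (X u v : CVec m) : omM S X u v = metM S X (cplx m u) v := rfl

theorem omM_skew (S : PSR m) {X : CVec m} (hX : X 0 ≠ 0) (u v : CVec m) :
    omM S X u v = -omM S X v u := by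
  rw [omM_apply, omM_apply, ← metM_cplx_cplx S hX, cplx_cplx, metM_symm S hX (cplx m v)]
  simp

theorem frame_apply (S : PSR m) {X : CVec m} (hX : X 0 ≠ 0) (u : Par m) (v : CVec m) :
    frame S X u v = u.1 ⬝ᵥ rv v - (hess S (zc X) (cv u.2) v).re := by
  rw [hess_eq_sum_left, Complex.re_sum, dotProduct, ← Finset.sum_sub_distrib, frame,
    sum_apply, sum_apply]
  refine Finset.sum_congr rfl fun i _ => ?_
  simp [dY_apply S hX, dRe, rv, cv]
  ring

/-! ### Nondegeneracy on `M` -/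

theorem caskM_zero_ne {S : PSR m} {X : CVec m} (hX : X ∈ caskM S) : X 0 ≠ 0 := by
  obtain ⟨z, _, h, _⟩ := hX
  exact h

theorem caskM_iv_zc {S : PSR m} {X : CVec m} (hX : X ∈ caskM S) : iv (zc X) ∈ cone S := by
  obtain ⟨z, hz, h, hX⟩ := hX
  have : zc X = z := by
    ext a
    simp [zc, Fin.tail, hX, h]
  rw [this]
  exact hz

theorem cone_tri_pos {S : PSR m} {y : Fin m → ℝ} (hy : y ∈ cone S) : 0 < tri S.k y y y := by
  obtain ⟨r, hr, t, ht, rfl⟩ := hy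
  obtain ⟨V, _, hH⟩ := S.hypersurface
  rw [hH] at ht
  have h1 : cubic S.k t = 1 := ht.2
  have h2 : tri S.k t t t = 6 := by
    rw [cubic] at h1; linarith
  rw [tri_smul_left, tri_smul_mid, tri_smul_right, h2]
  positivity

/-- Up to scale `y = t ∈ H`. A vector `u` in the kernel of `k(t, ·, ·)` satisfies `k(t, t, u) = 0`,
so it is tangent to `H`, where `-k(t, ·, ·)` is positive definite. -/
theorem cone_nondegenerate {S : PSR m} {y : Fin m → ℝ} (hy : y ∈ cone S) {u : Fin m → ℝ}
    (hu : ∀ v, tri S.k y u v = 0) : u = 0 := by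
  obtain ⟨r, hr, t, ht, rfl⟩ := hy
  have h : ∀ v, tri S.k t u v = 0 := fun v => by
    have := hu v
    rw [tri_smul_left] at this
    exact (mul_eq_zero.1 this).resolve_left hr.ne'
  by_contra hne
  have h1 := S.riemannian t ht u hne (by rw [tri_swap_right]; exact h t)
  rw [h u] at h1
  simp at h1

/-- The formula `imHess_eq` is block diagonal in `a⁰` and `a - a⁰ Re z`. Testing with `(1, Re z)`
isolates `a⁰`, with coefficient a positive multiple of `k(y, y, y)`; testing with `(0, w)` then
reduces to `cone_nondegenerate`. -/
theorem imHess_nondegenerate {S : PSR m} {z : Fin m → ℂ} (hz : iv z ∈ cone S)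
    {a : Fin (m + 1) → ℝ} (ha : ∀ b, imHess S z a b = 0) : a = 0 := by
  have h0 : a 0 = 0 := by
    have h := ha (Fin.cons 1 (rv z))
    rw [imHess_eq] at h
    have e : ∀ u v, tri S.k u v 0 = 0 := fun u v => by simpa using tri_smul_right S.k u v 0 0
    simp only [Fin.tail_cons, Fin.cons_zero, one_smul, sub_self, e, mul_one, neg_zero,
      zero_add] at h
    have := cone_tri_pos hz
    exact (mul_eq_zero.1 h).resolve_left (by positivity)
  have h1 : Fin.tail a = 0 := cone_nondegenerate hz fun w => by
    have h := ha (Fin.cons 0 w)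
    rw [imHess_eq] at h
    simpa [h0] using h
  ext i
  refine Fin.cases h0 (fun j => congrFun h1 j) i

theorem isInvertible_of_injective {E F : Type*} [NormedAddCommGroup E] [NormedSpace ℝ E]
    [FiniteDimensional ℝ E] [NormedAddCommGroup F] [NormedSpace ℝ F] [FiniteDimensional ℝ F]
    (f : E →L[ℝ] F) (hf : ∀ u, f u = 0 → u = 0)
    (hd : Module.finrank ℝ E = Module.finrank ℝ F) : f.IsInvertible := by
  have hinj : Function.Injective (f : E →ₗ[ℝ] F) :=
    (injective_iff_map_eq_zero (f : E →ₗ[ℝ] F)).2 hf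
  refine ⟨(LinearEquiv.ofInjectiveOfFinrankEq (f : E →ₗ[ℝ] F) hinj hd).toContinuousLinearEquiv, ?_⟩
  ext u
  rfl

theorem finrank_cVec (m : ℕ) : Module.finrank ℝ (CVec m) = 2 * (m + 1) := by
  simp [CVec, Module.finrank_pi_fintype, mul_comm]

instance : FiniteDimensional ℝ (Cov m) :=
  (LinearMap.toContinuousLinearMap (𝕜 := ℝ) (E := CVec m) (F' := ℝ)).finiteDimensional

theorem finrank_cov (m : ℕ) : Module.finrank ℝ (Cov m) = 2 * (m + 1) := by
  rw [← (LinearMap.toContinuousLinearMap (𝕜 := ℝ) (E := CVec m) (F' := ℝ)).finrank_eq,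
    ← finrank_cVec]
  exact Subspace.dual_finrank_eq

theorem finrank_par (m : ℕ) : Module.finrank ℝ (Par m) = 2 * (m + 1) := by
  simp [Par, Module.finrank_prod]; ring

theorem metM_isInvertible {S : PSR m} {X : CVec m} (hX : X ∈ caskM S) :
    (metM S X).IsInvertible := by
  refine isInvertible_of_injective _ (fun u hu => ?_) (by rw [finrank_cVec, finrank_cov])
  have h : ∀ v, metM S X u v = 0 := fun v => by rw [hu]; rfl
  simp only [metM_apply S (caskM_zero_ne hX)] at h
  have hr : rv u = 0 := imHess_nondegenerate (caskM_iv_zc hX) fun b => by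
    have e : iv (cv b) = 0 := by ext; simp [iv, cv]
    have := h (cv b)
    rwa [e, imHess_zero_right, add_zero] at this
  have hi : iv u = 0 := imHess_nondegenerate (caskM_iv_zc hX) fun b => by
    have e : iv (cplx m (cv b)) = b := by ext; simp [iv_cplx, rv, cv]
    have := h (cplx m (cv b))
    rwa [e, hr, imHess_zero_left, zero_add] at this
  ext i
  exact Complex.ext (congrFun hr i) (congrFun hi i)

theorem cplx_isInvertible : (cplx m).IsInvertible :=
  isInvertible_of_injective _ (fun u hu => by
    rw [← neg_eq_zero, ← cplx_cplx, hu, map_zero]) rfl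

theorem omM_isInvertible {S : PSR m} {X : CVec m} (hX : X ∈ caskM S) :
    (omM S X).IsInvertible :=
  (metM_isInvertible hX).comp cplx_isInvertible

theorem omM_omSharp {S : PSR m} {X : CVec m} (hX : X ∈ caskM S) (α : Cov m) :
    omM S X (omSharp S X α) = α :=
  (omM_isInvertible hX).self_apply_inverse α

/-- The `dxⁱ` vanish on imaginary vectors `i b`, where the `dyᵢ` give `Im τ`; nondegeneracy kills
the `dy` coefficients. Real vectors then detect the `dx` coefficients, and equality of dimensions
concludes. -/
theorem frame_isInvertible {S : PSR m} {X : CVec m} (hX : X ∈ caskM S) :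
    (frame S X).IsInvertible := by
  refine isInvertible_of_injective _ (fun u hu => ?_) (by rw [finrank_par, finrank_cov])
  have h : ∀ v, frame S X u v = 0 := fun v => by rw [hu]; rfl
  simp only [frame_apply S (caskM_zero_ne hX)] at h
  have h2 : u.2 = 0 := imHess_nondegenerate (caskM_iv_zc hX) fun b => by
    have e : rv (Complex.I • cv b) = 0 := by ext; simp [rv, cv]
    have := h (Complex.I • cv b)
    rw [e, hess_smul_right] at this
    simpa [imHess] using this
  have h1 : u.1 = 0 := dotProduct_eq _ _ fun b => by
    have e : rv (cv b) = b := by ext; simp [rv, cv]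
    have e0 : cv (0 : Fin (m + 1) → ℝ) = (0 : ℂ) • (0 : CVec m) := by ext; simp [cv]
    have := h (cv b)
    rw [e, h2, e0, hess_smul_left] at this
    simpa using this
  exact Prod.ext h1 h2

/-- In Darboux coordinates the `dy` coefficients of a covector are the `x`-components of its dual
vector. Pairing with imaginary vectors leaves `Im τ` on both sides, which is nondegenerate. -/
theorem rv_omSharp_frame {S : PSR m} {X : CVec m} (hX : X ∈ caskM S) (u : Par m) :
    rv (omSharp S X (frame S X u)) = u.2 := by
  have hX0 := caskM_zero_ne hX
  rw [← sub_eq_zero]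
  refine imHess_nondegenerate (caskM_iv_zc hX) fun b => ?_
  have h : omM S X (omSharp S X (frame S X u)) (cplx m (cv b)) = _ :=
    congrArg (fun α : Cov m => α (cplx m (cv b))) (omM_omSharp hX (frame S X u))
  have e1 : rv (cplx m (cv b)) = 0 := by ext; simp [rv_cplx, iv, cv]
  have e2 : iv (cplx m (cv b)) = b := by ext; simp [iv_cplx, rv, cv]
  have e3 : cplx m (cv b) = Complex.I • cv b := rfl
  rw [omM_apply, metM_apply S hX0, frame_apply S hX0, e1, e2, iv_cplx, imHess_zero_right, e3,
    hess_smul_right, zero_add] at h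
  have e4 : imHess S (zc X) (rv (omSharp S X (frame S X u)) - u.2) b
      = imHess S (zc X) (rv (omSharp S X (frame S X u))) b - imHess S (zc X) u.2 b := by
    simp only [imHess_eq_sum, Pi.sub_apply, sub_mul, mul_sub, Finset.sum_sub_distrib]
  rw [e4, h]
  simp [imHess]

/-- The symplectic form on parallel one-forms is constant. -/
theorem omInv_frame {S : PSR m} {X : CVec m} (hX : X ∈ caskM S) (u v : Par m) :
    omInv S X (frame S X u) (frame S X v) = sympl u v := by
  have hX0 := caskM_zero_ne hX
  have key : ∀ (w : Par m) (V : CVec m), frame S X w V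
      = w.1 ⬝ᵥ rv V - (hess S (zc X) (cv w.2) (cv (rv V))).re + imHess S (zc X) w.2 (iv V) := by
    intro w V
    rw [frame_apply S hX0]
    conv_lhs => rw [← cv_rv_add V, hess_add_right, hess_smul_right, cv_rv_add]
    simp [imHess]; ring
  have h1 : omInv S X (frame S X u) (frame S X v)
      = frame S X u (omSharp S X (frame S X v)) := by
    rw [omInv, omM_omSharp hX]
  -- The imaginary part of the dual vector is known only through `Im τ`, which is all that `key`
  -- needs. In the final sum the two `Re τ` terms cancel by symmetry of the Hessian.
  have h4 : ∀ b, frame S X v (cv b) = -imHess S (zc X) (iv (omSharp S X (frame S X v))) b := by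
    intro b
    have h : omM S X (omSharp S X (frame S X v)) (cv b) = _ :=
      congrArg (fun α : Cov m => α (cv b)) (omM_omSharp hX (frame S X v))
    have e1 : rv (cv b) = b := by ext; simp [rv, cv]
    have e2 : iv (cv b) = 0 := by ext; simp [iv, cv]
    rw [← h, omM_apply, metM_apply S hX0, rv_cplx, e1, e2, imHess_zero_right, imHess_neg_left,
      add_zero]
  have h5 := h4 u.2
  rw [key v] at h5
  have e1 : rv (cv u.2) = u.2 := by ext; simp [rv, cv]
  have e2 : iv (cv u.2) = 0 := by ext; simp [iv, cv]
  rw [e1, e2, imHess_zero_right] at h5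
  rw [h1, key u, rv_omSharp_frame hX, imHess_symm, hess_symm, sympl, dotProduct_comm u.2]
  linarith

/-- This matches the Heisenberg cocycle with the vertical part of `ω₁ = g_N(I₁ ·, ·)`, as needed in
`omH_vertical_add`. -/
theorem omInv_eq_neg_metInv {S : PSR m} {X : CVec m} (hX : X ∈ caskM S) (α β : Cov m) :
    omInv S X α β = -metInv S X (α ∘L cplx m) β := by
  have hX0 := caskM_zero_ne hX
  have h1 : (metM S X).inverse (α ∘L cplx m) = omSharp S X α := by
    rw [(metM_isInvertible hX).inverse_apply_eq]
    ext w
    have h : omM S X (omSharp S X α) (cplx m w) = α (cplx m w) := by rw [omM_omSharp hX]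
    rw [omM_apply, metM_cplx_cplx S hX0] at h
    exact h.symm
  rw [metInv, h1, omInv, omM_skew S hX0, omM_omSharp hX β]

/-! ### The action of `Aff_H` on `M` -/

/-- The linear map `(X⁰, X) ↦ (r^{-3/2} X⁰, r^{-1/2} A X)`. -/
def linM (S : PSR m) (x : PosReal × autH S) (X : CVec m) : CVec m :=
  Fin.cons ((x.1.val ^ (-(3 / 2) : ℝ) : ℝ) * X 0)
    (((x.1.val ^ (-(1 / 2) : ℝ) : ℝ) : ℂ) • cAct x.2.val (Fin.tail X))

/-- The linear map `(X⁰, X) ↦ (X⁰, X + X⁰ b)`. -/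
def trM (b : Fin m → ℝ) (X : CVec m) : CVec m :=
  Fin.cons (X 0) (Fin.tail X + X 0 • cv b)

/-- The real version of `linM`. -/
def linR (S : PSR m) (x : PosReal × autH S) (a : Fin (m + 1) → ℝ) : Fin (m + 1) → ℝ :=
  Fin.cons (x.1.val ^ (-(3 / 2) : ℝ) * a 0)
    (x.1.val ^ (-(1 / 2) : ℝ) • (x.2.val.val *ᵥ Fin.tail a))

/-- The real version of `trM`. -/
def trR (b : Fin m → ℝ) (a : Fin (m + 1) → ℝ) : Fin (m + 1) → ℝ :=
  Fin.cons (a 0) (Fin.tail a + a 0 • b)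

theorem affM_eq (S : PSR m) (g : AffH S) (X : CVec m) :
    affM S g X = trM g.left.toAdd (linM S g.right X) := rfl

theorem cons_ext {α : Type*} {u v : Fin (m + 1) → α} (h0 : u 0 = v 0)
    (h1 : Fin.tail u = Fin.tail v) : u = v := by
  rw [← Fin.cons_self_tail u, ← Fin.cons_self_tail v, h0, h1]

theorem rv_cAct (A : GL (Fin m) ℝ) (u : Fin m → ℂ) : rv (cAct A u) = A.val *ᵥ rv u := by
  ext a; simp [rv, cAct, Matrix.mulVec, dotProduct]

theorem iv_cAct (A : GL (Fin m) ℝ) (u : Fin m → ℂ) : iv (cAct A u) = A.val *ᵥ iv u := by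
  ext a; simp [iv, cAct, Matrix.mulVec, dotProduct]

theorem rv_tail (u : CVec m) : Fin.tail (rv u) = rv (Fin.tail u) := rfl

theorem iv_tail (u : CVec m) : Fin.tail (iv u) = iv (Fin.tail u) := rfl

theorem rv_ofReal_smul {ι : Type*} (r : ℝ) (u : ι → ℂ) : rv ((r : ℂ) • u) = r • rv u := by
  ext; simp [rv]

theorem iv_ofReal_smul {ι : Type*} (r : ℝ) (u : ι → ℂ) : iv ((r : ℂ) • u) = r • iv u := by
  ext; simp [iv]

theorem rv_linM (S : PSR m) (x : PosReal × autH S) (u : CVec m) :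
    rv (linM S x u) = linR S x (rv u) := by
  refine cons_ext (Complex.re_ofReal_mul _ _) ?_
  rw [rv_tail, linM, linR, Fin.tail_cons, Fin.tail_cons, rv_ofReal_smul, rv_cAct, rv_tail]

theorem iv_linM (S : PSR m) (x : PosReal × autH S) (u : CVec m) :
    iv (linM S x u) = linR S x (iv u) := by
  refine cons_ext (Complex.im_ofReal_mul _ _) ?_
  rw [iv_tail, linM, linR, Fin.tail_cons, Fin.tail_cons, iv_ofReal_smul, iv_cAct, iv_tail]

theorem rv_trM (b : Fin m → ℝ) (u : CVec m) : rv (trM b u) = trR b (rv u) := by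
  refine cons_ext rfl ?_
  ext a; simp [rv, trM, trR, cv, Fin.tail]

theorem iv_trM (b : Fin m → ℝ) (u : CVec m) : iv (trM b u) = trR b (iv u) := by
  refine cons_ext rfl ?_
  ext a; simp [iv, trM, trR, cv, Fin.tail]

theorem cv_linR (S : PSR m) (x : PosReal × autH S) (a : Fin (m + 1) → ℝ) :
    cv (linR S x a) = linM S x (cv a) := by
  have h1 : rv (linM S x (cv a)) = linR S x a := by rw [rv_linM]; rfl
  have h2 : iv (linM S x (cv a)) = 0 := by
    have : iv (cv a) = 0 := by ext; simp [iv, cv]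
    rw [iv_linM, this]
    refine cons_ext (by simp [linR]) ?_
    have : Fin.tail (0 : Fin (m + 1) → ℝ) = 0 := rfl
    simp [linR, this]
  conv_rhs => rw [← cv_rv_add (linM S x (cv a)), h1, h2]
  ext; simp [cv]

theorem cv_trR (b : Fin m → ℝ) (a : Fin (m + 1) → ℝ) : cv (trR b a) = trM b (cv a) := by
  refine cons_ext rfl ?_
  ext i; simp [trM, trR, cv, Fin.tail]

/-- Passing to `s = √r` turns all half-integral powers of `r` into integral powers, which
`field_simp` can handle. -/
theorem rpow_half_aux {r : ℝ} (hr : 0 < r) : ∃ s : ℝ, 0 < s ∧ r = s ^ 2 ∧ r ^ (1 / 2 : ℝ) = s ∧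
    r ^ (3 / 2 : ℝ) = s ^ 3 ∧ r ^ (-(1 / 2) : ℝ) = s⁻¹ ∧ r ^ (-(3 / 2) : ℝ) = (s ^ 3)⁻¹ := by
  have hs := Real.sqrt_pos.2 hr
  have hsx := Real.sq_sqrt hr.le
  have r1 : r ^ (1 / 2 : ℝ) = √r := (Real.sqrt_eq_rpow r).symm
  have r2 : r ^ (3 / 2 : ℝ) = √r ^ 3 := by
    rw [Real.sqrt_eq_rpow, ← Real.rpow_natCast, ← Real.rpow_mul hr.le]; norm_num
  exact ⟨√r, hs, hsx.symm, r1, r2, by rw [Real.rpow_neg hr.le, r1], by rw [Real.rpow_neg hr.le, r2]⟩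

/-- `Aut(H)` preserves the trilinear form. The weights are `r` for `z`, `r^{-1/2}` for the tails and
`r^{-3/2}` for the zeroth components, so every term of `hess` has total weight zero. -/
theorem hess_linM (S : PSR m) (x : PosReal × autH S) (z : Fin m → ℂ) (u v : CVec m) :
    hess S ((x.1.val : ℂ) • cAct x.2.val z) (linM S x u) (linM S x v) = hess S z u v := by
  obtain ⟨s, hs, r0, -, -, r3, r4⟩ := rpow_half_aux x.1.2
  have hs' : (s : ℂ) ≠ 0 := by exact_mod_cast hs.ne'
  simp only [hess, linM, Fin.tail_cons, Fin.cons_zero, r3, r4, ctri_smul_left, ctri_smul_mid,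
    ctri_smul_right, ctri_autH]
  simp only [r0]
  push_cast
  field_simp

/-- The correction does not involve `z` and has real coefficients. Its real part is what `pushTr`
records in the `dx` coefficients. -/
theorem hess_trM (S : PSR m) (b : Fin m → ℝ) (z : Fin m → ℂ) (u v : CVec m) :
    hess S (z + cv b) (trM b u) (trM b v) = hess S z u v
      - (ctri S.k (cv b) (Fin.tail u) (Fin.tail v)
        + 1 / 2 * ctri S.k (cv b) (cv b) (Fin.tail v) * u 0
        + 1 / 2 * ctri S.k (cv b) (cv b) (Fin.tail u) * v 0
        + 1 / 3 * ctri S.k (cv b) (cv b) (cv b) * u 0 * v 0) := by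
  have p := ctri_swap_left S
  have q := ctri_swap_right S
  simp only [hess, trM, Fin.tail_cons, Fin.cons_zero]
  generalize Fin.tail u = u', Fin.tail v = v', cv b = c
  simp only [ctri_add_left, ctri_add_mid, ctri_add_right, ctri_smul_mid, ctri_smul_right]
  rw [q z u' c, q c u' c, p c z u', p c z v', p c z z, q z c z, p c z c, q c c z, p c z c]
  ring

theorem imHess_linR (S : PSR m) (x : PosReal × autH S) (z : Fin m → ℂ) (a b : Fin (m + 1) → ℝ) :
    imHess S ((x.1.val : ℂ) • cAct x.2.val z) (linR S x a) (linR S x b) = imHess S z a b := by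
  rw [imHess, cv_linR, cv_linR, hess_linM, imHess]

/-- The quantities `Im z` and `a - a⁰ Re z` in `imHess_eq` are both unchanged by a real translation.
-/
theorem imHess_trR (S : PSR m) (t : Fin m → ℝ) (z : Fin m → ℂ) (a b : Fin (m + 1) → ℝ) :
    imHess S (z + cv t) (trR t a) (trR t b) = imHess S z a b := by
  have h1 : iv (z + cv t) = iv z := by ext; simp [iv, cv]
  have h2 : rv (z + cv t) = rv z + t := by ext; simp [rv, cv]
  have h3 : ∀ a, Fin.tail (trR t a) - trR t a 0 • (rv z + t) = Fin.tail a - a 0 • rv z := by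
    intro a
    simp only [trR, Fin.tail_cons, Fin.cons_zero]
    module
  rw [imHess_eq, imHess_eq, h1, h2, h3, h3]
  rfl

theorem dot_eq_head_tail (a b : Fin (m + 1) → ℝ) :
    a ⬝ᵥ b = a 0 * b 0 + Fin.tail a ⬝ᵥ Fin.tail b := by
  simp [dotProduct, Fin.sum_univ_succ, Fin.tail]

theorem ctri_cv_cv_re (k : Fin m → Fin m → Fin m → ℝ) (a b : Fin m → ℝ) (w : Fin m → ℂ) :
    (ctri k (cv a) (cv b) w).re = tri k a b (rv w) := by
  conv_lhs => rw [← cv_rv_add w]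
  rw [ctri_add_right, ctri_smul_right, ctri_cv, ctri_cv]
  simp

theorem frame_linM (S : PSR m) (x : PosReal × autH S) (z : Fin m → ℂ) (u : Par m) (v : CVec m) :
    (pushLin S x u).1 ⬝ᵥ rv (linM S x v)
      - (hess S ((x.1.val : ℂ) • cAct x.2.val z) (cv (pushLin S x u).2) (linM S x v)).re
      = u.1 ⬝ᵥ rv v - (hess S z (cv u.2) v).re := by
  have h : (pushLin S x u).2 = linR S x u.2 := rfl
  obtain ⟨s, hs, -, r1, r2, r3, r4⟩ := rpow_half_aux x.1.2
  rw [h, cv_linR, hess_linM, rv_linM, dot_eq_head_tail, dot_eq_head_tail u.1]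
  simp only [pushLin, linR, Fin.tail_cons, Fin.cons_zero, smul_dotProduct, dotProduct_smul,
    dot_autH, smul_eq_mul, r1, r2, r3, r4]
  field_simp

/-- The `dx` coefficients of `pushTr` are those that cancel both the shear of `Re v` and the real
part of the correction in `hess_trM`. -/
theorem frame_trM (S : PSR m) (b : Fin m → ℝ) (z : Fin m → ℂ) (u : Par m) (v : CVec m) :
    (pushTr S b u).1 ⬝ᵥ rv (trM b v) - (hess S (z + cv b) (cv (pushTr S b u).2) (trM b v)).re
      = u.1 ⬝ᵥ rv v - (hess S z (cv u.2) v).re := by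
  have h : (pushTr S b u).2 = trR b u.2 := rfl
  have h1 : Fin.tail (cv u.2) = cv (Fin.tail u.2) := rfl
  have h2 : cv u.2 0 = (u.2 0 : ℂ) := rfl
  have h3 : rv v 0 = (v 0).re := rfl
  rw [h, cv_trR, hess_trM, rv_trM, dot_eq_head_tail, dot_eq_head_tail u.1]
  simp only [pushTr, trR, Fin.tail_cons, Fin.cons_zero, contr_dot, sub_dotProduct,
    smul_dotProduct, dotProduct_add, dotProduct_smul, smul_eq_mul, h1, h2, h3, rv_tail]
  have c1 : (1 / 2 : ℂ) = ((1 / 2 : ℝ) : ℂ) := by norm_num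
  have c2 : (1 / 3 : ℂ) = ((1 / 3 : ℝ) : ℂ) := by norm_num
  have e1 : (ctri S.k (cv b) (cv (Fin.tail u.2)) (Fin.tail v)
        + 1 / 2 * ctri S.k (cv b) (cv b) (Fin.tail v) * (u.2 0 : ℂ)
        + 1 / 2 * ctri S.k (cv b) (cv b) (cv (Fin.tail u.2)) * v 0
        + 1 / 3 * ctri S.k (cv b) (cv b) (cv b) * (u.2 0 : ℂ) * v 0).re
      = tri S.k b (Fin.tail u.2) (rv (Fin.tail v)) + 1 / 2 * tri S.k b b (rv (Fin.tail v)) * u.2 0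
        + 1 / 2 * tri S.k b b (Fin.tail u.2) * (v 0).re
        + 1 / 3 * tri S.k b b b * u.2 0 * (v 0).re := by
    rw [c1, c2, ctri_cv, ctri_cv]
    simp only [Complex.add_re, ctri_cv_cv_re, mul_assoc, Complex.re_ofReal_mul, Complex.re_mul_ofReal]
  rw [Complex.sub_re, e1, tri_swap_right S b (Fin.tail u.2) b]
  ring

theorem zc_linM (S : PSR m) (x : PosReal × autH S) {X : CVec m} :
    zc (linM S x X) = (x.1.val : ℂ) • cAct x.2.val (zc X) := by
  obtain ⟨s, hs, r0, -, -, r3, r4⟩ := rpow_half_aux x.1.2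
  have hs' : (s : ℂ) ≠ 0 := by exact_mod_cast hs.ne'
  simp only [zc, linM, Fin.tail_cons, Fin.cons_zero, cAct_smul, smul_smul, r3, r4]
  simp only [r0]
  congr 1
  push_cast
  field_simp

theorem zc_trM (b : Fin m → ℝ) {X : CVec m} (hX : X 0 ≠ 0) : zc (trM b X) = zc X + cv b := by
  simp [zc, trM, smul_add, smul_smul, hX]

theorem affM_zero_ne (S : PSR m) (g : AffH S) {X : CVec m} (hX : X 0 ≠ 0) :
    affM S g X 0 ≠ 0 := by
  have h : g.right.1.val ^ (-(3 / 2) : ℝ) ≠ 0 := (Real.rpow_pos_of_pos g.right.1.2 _).ne'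
  exact mul_ne_zero (by exact_mod_cast h) hX

theorem linM_zero_ne (S : PSR m) (x : PosReal × autH S) {X : CVec m} (hX : X 0 ≠ 0) :
    linM S x X 0 ≠ 0 := by
  have h : x.1.val ^ (-(3 / 2) : ℝ) ≠ 0 := (Real.rpow_pos_of_pos x.1.2 _).ne'
  exact mul_ne_zero (by exact_mod_cast h) hX

theorem zc_affM (S : PSR m) (g : AffH S) {X : CVec m} (hX : X 0 ≠ 0) :
    zc (affM S g X) = (g.right.1.val : ℂ) • cAct g.right.2.val (zc X) + cv g.left.toAdd := by
  rw [affM_eq, zc_trM _ (linM_zero_ne S _ hX), zc_linM]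

/-- The imaginary part of `z` transforms by `y ↦ r A y`, which preserves the cone over `H`; the
translation affects only the real part. -/
theorem affM_mem_caskM (S : PSR m) (g : AffH S) {X : CVec m} (hX : X ∈ caskM S) :
    affM S g X ∈ caskM S := by
  have h0 := caskM_zero_ne hX
  have h1 := affM_zero_ne S g h0
  refine ⟨zc (affM S g X), ?_, h1, fun a => ?_⟩
  · obtain ⟨r, hr, t, ht, he⟩ := caskM_iv_zc hX
    have h2 : iv (zc (affM S g X)) = g.right.1.val • (g.right.2.val.val *ᵥ iv (zc X)) := by
      rw [zc_affM S g h0, ← iv_cAct, ← iv_ofReal_smul]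
      ext; simp [iv, cv]
    have hA : (fun t => g.right.2.val.val *ᵥ t) '' S.H = S.H := g.right.2.2
    refine ⟨g.right.1.val * r, mul_pos g.right.1.2 hr, g.right.2.val.val *ᵥ t, ?_, ?_⟩
    · rw [← hA]; exact ⟨t, ht, rfl⟩
    · refine h2.trans ?_
      rw [he, Matrix.mulVec_smul, smul_smul]
  · simp [zc, h1, Fin.tail]

theorem metM_affM (S : PSR m) (g : AffH S) {X : CVec m} (hX : X 0 ≠ 0) (u v : CVec m) :
    metM S (affM S g X) (affM S g u) (affM S g v) = metM S X u v := by
  rw [metM_apply S (affM_zero_ne S g hX), metM_apply S hX, zc_affM S g hX]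
  simp only [affM_eq, rv_trM, iv_trM, rv_linM, iv_linM, imHess_trR, imHess_linR]

/-- Naturality of the parallel frame. -/
theorem frame_affM (S : PSR m) (g : AffH S) {X : CVec m} (hX : X 0 ≠ 0) (u : Par m) (v : CVec m) :
    frame S (affM S g X) (push S g u) (affM S g v) = frame S X u v := by
  rw [frame_apply S (affM_zero_ne S g hX), frame_apply S hX, zc_affM S g hX, affM_eq, push,
    frame_trM, frame_linM]

theorem affM_one (S : PSR m) (X : CVec m) : affM S 1 X = X := by
  rw [affM_eq]
  refine cons_ext (by simp [trM, linM]) ?_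
  have : cv (0 : Fin m → ℝ) = 0 := by ext; simp [cv]
  simp [trM, linM, this, cAct_one]

theorem affM_mul (S : PSR m) (g g' : AffH S) (X : CVec m) :
    affM S (g * g') X = affM S g (affM S g' X) := by
  obtain ⟨s, hs, r0, -, -, r3, r4⟩ := rpow_half_aux g.right.1.2
  obtain ⟨s', hs', r0', -, -, r3', r4'⟩ := rpow_half_aux g'.right.1.2
  have hs1 : (s : ℂ) ≠ 0 := by exact_mod_cast hs.ne'
  have hs1' : (s' : ℂ) ≠ 0 := by exact_mod_cast hs'.ne'
  have h := fun p => Real.mul_rpow (z := p) g.right.1.2.le g'.right.1.2.le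
  have hl : cv (g * g').left.toAdd
      = cv g.left.toAdd + (g.right.1.val : ℂ) • cAct g.right.2.val (cv g'.left.toAdd) := by
    rw [cAct_cv]
    ext a
    simp [cv, linHom, linAct]
  simp only [affM_eq, trM, linM, hl]
  refine cons_ext ?_ ?_
  · simp [h, mul_assoc]
  · simp only [Fin.tail_cons, Fin.cons_zero, SemidirectProduct.mul_right, Prod.fst_mul,
      Prod.snd_mul, Subgroup.coe_mul, Positive.val_mul, cAct_mul, cAct_smul, cAct_add, h, r3, r3',
      r4, r4', smul_smul, smul_add]
    simp only [r0]
    push_cast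
    match_scalars <;> field_simp

/-- The linear action of an element of `Aff_H` on `ℂⁿ`. -/
def affL (S : PSR m) (g : AffH S) : CVec m ≃L[ℝ] CVec m :=
  LinearEquiv.toContinuousLinearEquiv
    { toFun := affM S g
      invFun := affM S g⁻¹
      left_inv := fun X => by rw [← affM_mul, inv_mul_cancel, affM_one]
      right_inv := fun X => by rw [← affM_mul, mul_inv_cancel, affM_one]
      map_add' := fun X Y => by
        refine cons_ext ?_ ?_
        · simp [affM_eq, trM, linM, mul_add]
        · simp only [affM_eq, trM, linM, Fin.tail_cons, Fin.cons_zero, ctail_add, cAct_add,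
            Pi.add_apply]
          module
      map_smul' := fun r X => by
        refine cons_ext ?_ ?_
        · simp [affM_eq, trM, linM, mul_left_comm]
        · have h : Fin.tail (r • X) = (r : ℂ) • Fin.tail X := by ext; simp [Fin.tail]
          simp only [affM_eq, trM, linM, Fin.tail_cons, Fin.cons_zero, h, cAct_smul,
            Pi.smul_apply, Complex.real_smul, RingHom.id_apply]
          ext a
          simp [Fin.tail]
          ring }

theorem cplx_affM (S : PSR m) (g : AffH S) (X : CVec m) :
    cplx m (affM S g X) = affM S g (cplx m X) := by
  refine cons_ext ?_ ?_
  · simp [cplx, affM_eq, trM, linM, mul_left_comm]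
  · have h : ∀ Y : CVec m, cplx m Y = Complex.I • Y := fun _ => rfl
    simp only [h, affM_eq, trM, linM, Fin.tail_cons, ctail_smul, cAct_smul, Fin.cons_zero,
      Pi.smul_apply, smul_eq_mul]
    module

/-! ### Naturality of the tensors under `Aff_H` -/

/-- Push-forward of covectors under an element of `Aff_H`. -/
def covL (S : PSR m) (g : AffH S) : Cov m ≃L[ℝ] Cov m :=
  (affL S g).arrowCongr (ContinuousLinearEquiv.refl ℝ ℝ)

theorem covL_apply (S : PSR m) (g : AffH S) (α : Cov m) (v : CVec m) :
    covL S g α v = α (affM S g⁻¹ v) := rfl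

theorem covL_affM (S : PSR m) (g : AffH S) (α : Cov m) (v : CVec m) :
    covL S g α (affM S g v) = α v := by
  rw [covL_apply, ← affM_mul, inv_mul_cancel, affM_one]

theorem affM_affM_inv (S : PSR m) (g : AffH S) (v : CVec m) :
    affM S g (affM S g⁻¹ v) = v := by
  rw [← affM_mul, mul_inv_cancel, affM_one]

theorem cov_ext_affM (S : PSR m) (g : AffH S) {α β : Cov m}
    (h : ∀ v, α (affM S g v) = β (affM S g v)) : α = β := by
  ext v
  rw [← affM_affM_inv S g v]
  exact h _

theorem covL_comp_cplx (S : PSR m) (g : AffH S) (α : Cov m) :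
    covL S g α ∘L cplx m = covL S g (α ∘L cplx m) :=
  cov_ext_affM S g fun v => by
    rw [ContinuousLinearMap.comp_apply, cplx_affM, covL_affM, covL_affM]
    rfl

theorem frame_push (S : PSR m) (g : AffH S) {X : CVec m} (hX : X 0 ≠ 0) (u : Par m) :
    frame S (affM S g X) (push S g u) = covL S g (frame S X u) :=
  cov_ext_affM S g fun v => by rw [frame_affM S g hX, covL_affM]

/-- Invariance restated as equivariance of `u ↦ g(u, ·)`, the form that passes to the inverse map
and hence to `g⁻¹` and `ω⁻¹`. -/
theorem metM_covL (S : PSR m) (g : AffH S) {X : CVec m} (hX : X 0 ≠ 0) (u : CVec m) :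
    metM S (affM S g X) (affM S g u) = covL S g (metM S X u) :=
  cov_ext_affM S g fun v => by rw [metM_affM S g hX, covL_affM]

theorem omM_covL (S : PSR m) (g : AffH S) {X : CVec m} (hX : X 0 ≠ 0) (u : CVec m) :
    omM S (affM S g X) (affM S g u) = covL S g (omM S X u) := by
  have h : ∀ Y v : CVec m, omM S Y v = metM S Y (cplx m v) := fun _ _ => rfl
  rw [h, h, cplx_affM, metM_covL S g hX]

theorem metM_inverse_covL {S : PSR m} (g : AffH S) {X : CVec m} (hX : X ∈ caskM S) (α : Cov m) :
    (metM S (affM S g X)).inverse (covL S g α) = affM S g ((metM S X).inverse α) := by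
  rw [(metM_isInvertible (affM_mem_caskM S g hX)).inverse_apply_eq,
    metM_covL S g (caskM_zero_ne hX), (metM_isInvertible hX).self_apply_inverse]

theorem omSharp_covL {S : PSR m} (g : AffH S) {X : CVec m} (hX : X ∈ caskM S) (α : Cov m) :
    omSharp S (affM S g X) (covL S g α) = affM S g (omSharp S X α) := by
  rw [omSharp, (omM_isInvertible (affM_mem_caskM S g hX)).inverse_apply_eq,
    omM_covL S g (caskM_zero_ne hX), omM_omSharp hX]

theorem metInv_covL {S : PSR m} (g : AffH S) {X : CVec m} (hX : X ∈ caskM S) (α β : Cov m) :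
    metInv S (affM S g X) (covL S g α) (covL S g β) = metInv S X α β := by
  rw [metInv, metM_inverse_covL g hX, covL_affM, metInv]

/-- The action of an element of `Aff_H` on `T_X M ⊕ T*_X M`. -/
def splitAct (S : PSR m) (g : AffH S) (A : Split m) : Split m := (affM S g A.1, covL S g A.2)

theorem metN_splitAct {S : PSR m} (g : AffH S) {X : CVec m} (hX : X ∈ caskM S) (A B : Split m) :
    metN S (affM S g X) (splitAct S g A) (splitAct S g B) = metN S X A B := by
  simp only [metN, splitAct, metM_affM S g (caskM_zero_ne hX), metInv_covL g hX]

theorem cplx1_splitAct (S : PSR m) (g : AffH S) (A : Split m) :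
    cplx1 (splitAct S g A) = splitAct S g (cplx1 A) := by
  simp only [cplx1, splitAct, cplx_affM, covL_comp_cplx]

theorem affM_neg (S : PSR m) (g : AffH S) (u : CVec m) : affM S g (-u) = -affM S g u :=
  map_neg (affL S g) u

theorem cplx2_splitAct {S : PSR m} (g : AffH S) {X : CVec m} (hX : X ∈ caskM S) (A : Split m) :
    cplx2 S (affM S g X) (splitAct S g A) = splitAct S g (cplx2 S X A) := by
  simp only [cplx2, splitAct, omSharp_covL g hX, omM_covL S g (caskM_zero_ne hX), affM_neg]

theorem cplx3_splitAct {S : PSR m} (g : AffH S) {X : CVec m} (hX : X ∈ caskM S) (A : Split m) :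
    cplx3 S (affM S g X) (splitAct S g A) = splitAct S g (cplx3 S X A) := by
  simp only [cplx3, cplx2_splitAct g hX, cplx1_splitAct]

theorem rotZ_affM (S : PSR m) (g : AffH S) (X : CVec m) :
    rotZ (affM S g X) = splitAct S g (rotZ X) := by
  simp only [rotZ, splitAct, cplx_affM, affM_neg, map_zero]

theorem zForm_affM (S : PSR m) (g : AffH S) {X : CVec m} (hX : X 0 ≠ 0) :
    zForm S (affM S g X) = covL S g (zForm S X) := by
  rw [zForm, cplx_affM, ← affM_neg, metM_covL S g hX, zForm]

/-- Differentiate the equivariance of `zForm`. The identity is available only where `X⁰ ≠ 0`, an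
open condition, and the actions on both sides are linear, so no second derivatives of the action
appear. -/
theorem fderiv_zForm_affM (S : PSR m) (g : AffH S) {X : CVec m} (hX : X 0 ≠ 0) (u v : CVec m) :
    fderiv ℝ (zForm S) (affM S g X) (affM S g u) (affM S g v) = fderiv ℝ (zForm S) X u v := by
  have h1 : zForm S ∘ affL S g =ᶠ[nhds X] covL S g ∘ zForm S := by
    filter_upwards [eventually_zero_ne hX] with Y hY
    exact zForm_affM S g hY
  have h2 := h1.fderiv_eq (𝕜 := ℝ)
  rw [(affL S g).comp_right_fderiv, (covL S g).comp_fderiv] at h2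
  have h3 := congrArg (fun f : CVec m →L[ℝ] Cov m => f u (affM S g v)) h2
  exact h3.trans (covL_affM S g _ v)

theorem omH_splitAct {S : PSR m} (g : AffH S) {X : CVec m} (hX : X ∈ caskM S) (A B : Split m) :
    omH S (affM S g X) (splitAct S g A) (splitAct S g B) = omH S X A B := by
  rw [omH, cplx1_splitAct, metN_splitAct g hX]
  simp only [splitAct, fderiv_zForm_affM S g (caskM_zero_ne hX)]
  rfl

theorem metN_rotZ_rotZ (S : PSR m) {X : CVec m} (hX : X 0 ≠ 0) :
    metN S X (rotZ X) (rotZ X) = metM S X X X := by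
  simp [metN, rotZ, metInv, metM_cplx_cplx S hX]

theorem fZ_affM (S : PSR m) (c : ℝ) (g : AffH S) {X : CVec m} (hX : X 0 ≠ 0) :
    fZ S c (affM S g X) = fZ S c X := by
  rw [fZ, fZ, metN_rotZ_rotZ S (affM_zero_ne S g hX), metN_rotZ_rotZ S hX, metM_affM S g hX]

theorem fderiv_fZ_affM (S : PSR m) (c : ℝ) (g : AffH S) {X : CVec m} (hX : X 0 ≠ 0)
    (u : CVec m) : fderiv ℝ (fZ S c) (affM S g X) (affM S g u) = fderiv ℝ (fZ S c) X u := by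
  have h1 : fZ S c ∘ affL S g =ᶠ[nhds X] fZ S c := by
    filter_upwards [eventually_zero_ne hX] with Y hY
    exact fZ_affM S c g hY
  have h2 := h1.fderiv_eq (𝕜 := ℝ)
  rw [(affL S g).comp_right_fderiv] at h2
  exact congrArg (fun f : CVec m →L[ℝ] ℝ => f u) h2

theorem fH_affM {S : PSR m} (c : ℝ) (g : AffH S) {X : CVec m} (hX : X ∈ caskM S) :
    fH S c (affM S g X) = fH S c X := by
  rw [fH, fH, rotZ_affM, metN_splitAct g hX, fZ_affM S c g (caskM_zero_ne hX)]

/-! ### Smoothness of the parallel frame -/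

theorem prepotGrad_contDiffAt (S : PSR m) {X : CVec m} (hX : X 0 ≠ 0) (u : CVec m) :
    ContDiffAt ℝ ∞ (fun Y => prepotGrad S Y u) X := by
  have h0 : ContDiff ℝ ∞ fun Y : CVec m => Y 0 := by fun_prop
  unfold prepotGrad ctri Fin.tail
  simp only [div_eq_mul_inv]
  refine ContDiffAt.add (ContDiffAt.mul (ContDiff.contDiffAt ?_) (h0.contDiffAt.inv hX))
    (ContDiffAt.mul (ContDiff.contDiffAt ?_) ((h0.pow 2).contDiffAt.inv (pow_ne_zero 2 hX)))
  all_goals fun_prop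

theorem dY_contDiffAt (S : PSR m) {X : CVec m} (hX : X 0 ≠ 0) (i : Fin (m + 1)) :
    ContDiffAt ℝ ∞ (dY S i) X := by
  have h : ContDiffAt ℝ ∞ (fun Y => -(prepotD S i Y).re) X :=
    (Complex.reCLM.contDiff.contDiffAt.comp X ((prepotGrad_contDiffAt S hX
      (Pi.single i 1)).congr_of_eventuallyEq (prepotD_eventuallyEq S hX i))).neg
  exact h.fderiv_right (by simp)

theorem frame_contDiffAt (S : PSR m) {X : CVec m} (hX : X 0 ≠ 0) :
    ContDiffAt ℝ ∞ (frame S) X := by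
  unfold frame
  refine ContDiffAt.sum fun i _ => contDiffAt_const.add ?_
  exact contDiffAt_const.smulRight (dY_contDiffAt S hX i)

/-- Identities for `coef` are going to be differentiated and must hold near a point. Invertibility
of the frame is an open condition and, with `X⁰ ≠ 0`, suffices for them, so openness of `M` is not
required. -/
theorem eventually_frame_isInvertible {S : PSR m} {X : CVec m} (hX : X ∈ caskM S) :
    ∀ᶠ Y in nhds X, (frame S Y).IsInvertible := by
  obtain ⟨e, he⟩ := frame_isInvertible hX
  have h := (frame_contDiffAt S (caskM_zero_ne hX)).continuousAt
  have hn := ContinuousLinearEquiv.nhds e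
  rw [he] at hn
  exact h.eventually hn

/-- The coefficients of a covector in the parallel frame. -/
def coef (S : PSR m) (y : CVec m × Cov m) : Par m := (frame S y.1).inverse y.2

theorem coef_contDiffAt {S : PSR m} {y : CVec m × Cov m} (hy : y.1 ∈ caskM S) :
    ContDiffAt ℝ ∞ (coef S) y := by
  have h1 : ContDiffAt ℝ ∞ (fun y : CVec m × Cov m => frame S y.1) y :=
    (frame_contDiffAt S (caskM_zero_ne hy)).comp y contDiffAt_fst
  have h2 : ContDiffAt ℝ ∞ (fun y : CVec m × Cov m => (frame S y.1).inverse) y :=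
    ((frame_isInvertible hy).contDiffAt_map_inverse (n := ∞)).comp (f := fun y : CVec m × Cov m =>
      frame S y.1) y h1
  exact h2.clm_apply contDiffAt_snd

theorem coef_differentiableAt {S : PSR m} {y : CVec m × Cov m} (hy : y.1 ∈ caskM S) :
    DifferentiableAt ℝ (coef S) y :=
  (coef_contDiffAt hy).differentiableAt (by simp)

theorem vert_eq (S : PSR m) (y A : CVec m × Cov m) :
    vert S y A = frame S y.1 (fderiv ℝ (coef S) y A) := rfl

theorem coef_covL {S : PSR m} (g : AffH S) {y : CVec m × Cov m} (hy : (frame S y.1).IsInvertible)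
    (hy0 : y.1 0 ≠ 0) : coef S (affM S g y.1, covL S g y.2) = push S g (coef S y) := by
  have hs : ∀ u, frame S (affM S g y.1) u = covL S g (frame S y.1 (push S g⁻¹ u)) := fun u => by
    rw [← frame_push S g hy0, ← push_mul, mul_inv_cancel, push_one]
  have hinv : (frame S (affM S g y.1)).IsInvertible := by
    refine isInvertible_of_injective _ (fun u hu => ?_) (by rw [finrank_par, finrank_cov])
    rw [hs, map_eq_zero_iff _ (covL S g).injective, map_eq_zero_iff _ hy.injective] at hu
    rw [← push_one S u, ← mul_inv_cancel g, push_mul, hu, push_zero]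
  rw [coef, hinv.inverse_apply_eq, frame_push S g hy0, coef, hy.self_apply_inverse]

/-- In the parallel frame, `g` acts on coefficients by a matrix independent of the point, so it
commutes with their differentiation: the action is affine for the flat connection. -/
theorem vert_affM {S : PSR m} (g : AffH S) {y : CVec m × Cov m} (hy : y.1 ∈ caskM S)
    (A : CVec m × Cov m) :
    vert S (affM S g y.1, covL S g y.2) (affM S g A.1, covL S g A.2)
      = covL S g (vert S y A) := by
  have hy0 := caskM_zero_ne hy
  have hgy := affM_mem_caskM S g hy
  let E : (CVec m × Cov m) ≃L[ℝ] (CVec m × Cov m) := (affL S g).prodCongr (covL S g)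
  -- `push S g` presented as a continuous linear map, by conjugating `covL` with the frames at the
  -- fixed base points.
  let P : Par m →L[ℝ] Par m :=
    (frame S (affM S g y.1)).inverse ∘L (covL S g : Cov m →L[ℝ] Cov m) ∘L frame S y.1
  have hP : ∀ u, P u = push S g u := fun u => by
    show (frame S (affM S g y.1)).inverse (covL S g (frame S y.1 u)) = _
    rw [(frame_isInvertible hgy).inverse_apply_eq, frame_push S g hy0]
  have h1 : coef S ∘ E =ᶠ[nhds y] P ∘ coef S := by
    filter_upwards [continuousAt_fst.eventually (eventually_frame_isInvertible hy),
      continuousAt_fst.eventually (eventually_zero_ne hy0)] with y' h h0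
    show coef S (affM S g y'.1, covL S g y'.2) = P (coef S y')
    rw [hP, coef_covL g h h0]
  have h2 := h1.fderiv_eq (𝕜 := ℝ)
  rw [E.comp_right_fderiv, (P.hasFDerivAt.comp y (coef_differentiableAt hy).hasFDerivAt).fderiv]
    at h2
  have h3 : fderiv ℝ (coef S) (affM S g y.1, covL S g y.2) (affM S g A.1, covL S g A.2)
      = P (fderiv ℝ (coef S) y A) := congrArg (fun f : CVec m × Cov m →L[ℝ] Par m => f A) h2
  rw [vert_eq, h3, hP, frame_push S g hy0, vert_eq]

/-! ### Invariance of the metric under `Aff_H` -/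

/-- The linear map of the ambient space extending the action of an element of `Aff_H`. -/
def affA (S : PSR m) (g : AffH S) : Amb m →L[ℝ] Amb m :=
  (affL S g : CVec m →L[ℝ] CVec m).prodMap
    ((covL S g : Cov m →L[ℝ] Cov m).prodMap (ContinuousLinearMap.id ℝ ℂ))

theorem affA_apply (S : PSR m) (g : AffH S) (p : Amb m) :
    affA S g p = (affM S g p.1, covL S g p.2.1, p.2.2) := rfl

theorem affP_eq (S : PSR m) (g : AffH S) (p : Amb m) : affP S g p = affA S g p := by
  have h : fderiv ℝ (affM S g⁻¹) (affM S g p.1) = affL S g⁻¹ := (affL S g⁻¹).fderiv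
  rw [affP, h]
  rfl

theorem toSplit_affA {S : PSR m} (g : AffH S) {p : Amb m} (hp : p.1 ∈ caskM S) (A : Amb m) :
    toSplit S (affA S g p) (affA S g A) = splitAct S g (toSplit S p A) := by
  simp only [toSplit, split, splitAct, affA_apply]
  rw [vert_affM g (y := (p.1, p.2.1)) hp (A.1, A.2.1)]

theorem eta_affA {S : PSR m} (g : AffH S) {p : Amb m} (hp : p.1 ∈ caskM S) (A : Amb m) :
    eta S (affA S g p) (affA S g A) = eta S p A := by
  rw [eta, toSplit_affA g hp, eta]
  -- In the splitting, `Ξ` at `(X, β)` is the pair `(X, β)` itself, so linearity of the action makes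
  -- `Ξ` invariant.
  have h : ((affA S g p).1, (affA S g p).2.1) = splitAct S g (p.1, p.2.1) := rfl
  rw [h, show (affA S g p).1 = affM S g p.1 from rfl, omH_splitAct g hp]
  rfl

theorem metQ_affA {S : PSR m} (c : ℝ) (g : AffH S) {p : Amb m} (hp : p.1 ∈ caskM S)
    (A B : Amb m) :
    metQ S c (affA S g p) (affA S g A) (affA S g B) = metQ S c p A B := by
  have h : (affA S g p).1 = affM S g p.1 := rfl
  have h' : ∀ A, (affA S g A).1 = affM S g A.1 := fun _ => rfl
  have h0 := caskM_zero_ne hp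
  simp only [metQ, metP, theta0, theta1, theta2, theta3, eta_affA g hp, toSplit_affA g hp, h, h',
    fZ_affM S c g h0, fH_affM c g hp, fderiv_fZ_affM S c g h0, rotZ_affM, cplx2_splitAct g hp,
    cplx3_splitAct g hp, metN_splitAct g hp]

/-! ### Invariance of the metric under the Heisenberg group -/

/-- The symplectic pairing with a fixed vector as a continuous linear form. -/
def symplL (u : Par m) : Par m →L[ℝ] ℝ :=
  LinearMap.toContinuousLinearMap
    { toFun := sympl u
      map_add' := fun v w => by
        simp only [sympl, Prod.fst_add, Prod.snd_add, dotProduct_add]; ring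
      map_smul' := fun r v => by
        simp only [sympl, Prod.smul_fst, Prod.smul_snd, dotProduct_smul, smul_eq_mul,
          RingHom.id_apply]
        ring }

theorem symplL_apply (u v : Par m) : symplL u v = sympl u v := rfl

theorem frame_coef {S : PSR m} {X : CVec m} (hX : X ∈ caskM S) (β : Cov m) :
    frame S X (coef S (X, β)) = β :=
  (frame_isInvertible hX).self_apply_inverse β

theorem coef_frame_add {S : PSR m} {X : CVec m} (hX : (frame S X).IsInvertible) (u : Par m)
    (β : Cov m) : coef S (X, frame S X u + β) = u + coef S (X, β) := by
  rw [coef, map_add, hX.inverse_apply_self, coef]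

theorem omInv_frame_left {S : PSR m} {X : CVec m} (hX : X ∈ caskM S) (u : Par m) (β : Cov m) :
    omInv S X (frame S X u) β = sympl u (coef S (X, β)) := by
  conv_lhs => rw [← frame_coef hX β]
  rw [omInv_frame hX]

/-- The phase by which an element of the Heisenberg group rotates the circle fibre. -/
def phase (S : PSR m) (x : Heis m) (p : Amb m) : ℝ :=
  x.ctr + (1 / 2) * symplL x.form (coef S (p.1, p.2.1))

/-- The extension of the action of an element of the Heisenberg group to the ambient space. -/
def heisA (S : PSR m) (x : Heis m) (p : Amb m) : Amb m :=
  (p.1, frame S p.1 x.form + p.2.1, p.2.2 * Complex.exp (Complex.I * (phase S x p : ℂ)))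

theorem heisP_eq {S : PSR m} (x : Heis m) {p : Amb m} (hp : p.1 ∈ caskM S) :
    heisP S x p = heisA S x p := by
  rw [heisP, omInv_frame_left hp, heisA, phase, symplL_apply]

/-- The projection of the ambient space onto `N`. -/
def projN (m : ℕ) : Amb m →L[ℝ] CVec m × Cov m :=
  (ContinuousLinearMap.fst ℝ _ _).prod
    (ContinuousLinearMap.fst ℝ _ _ ∘L ContinuousLinearMap.snd ℝ _ _)

theorem phase_contDiffAt {S : PSR m} (x : Heis m) {p : Amb m} (hp : p.1 ∈ caskM S) :
    ContDiffAt ℝ ∞ (phase S x) p := by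
  have h : ContDiffAt ℝ ∞ (coef S ∘ projN m) p :=
    ContDiffAt.comp p (coef_contDiffAt (y := projN m p) hp) (projN m).contDiff.contDiffAt
  exact contDiffAt_const.add (contDiffAt_const.mul
    ((symplL x.form).contDiff.contDiffAt.comp p h))

theorem heisA_contDiffAt {S : PSR m} (x : Heis m) {p : Amb m} (hp : p.1 ∈ caskM S) :
    ContDiffAt ℝ ∞ (heisA S x) p := by
  have h1 : ContDiffAt ℝ ∞ (fun p : Amb m => frame S p.1) p :=
    (frame_contDiffAt S (caskM_zero_ne hp)).comp p contDiffAt_fst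
  have h2 : ContDiffAt ℝ ∞ (fun p => (phase S x p : ℂ)) p :=
    Complex.ofRealCLM.contDiff.contDiffAt.comp p (phase_contDiffAt x hp)
  have h3 : ContDiffAt ℝ ∞ (fun p : Amb m => p.2.1) p := by fun_prop
  have h4 : ContDiffAt ℝ ∞ (fun p : Amb m => p.2.2) p := by fun_prop
  exact contDiffAt_fst.prodMk (((h1.clm_apply contDiffAt_const).add h3).prodMk
    (h4.mul (contDiffAt_const.mul h2).cexp))

theorem fderiv_phase {S : PSR m} (x : Heis m) {p : Amb m} (hp : p.1 ∈ caskM S) (A : Amb m) :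
    fderiv ℝ (phase S x) p A
      = (1 / 2) * sympl x.form (fderiv ℝ (coef S) (p.1, p.2.1) (A.1, A.2.1)) := by
  have h1 := (coef_differentiableAt (S := S) (y := projN m p) hp).hasFDerivAt.comp p
    (projN m).hasFDerivAt
  have h2 := (((symplL x.form).hasFDerivAt.comp p h1).const_mul (1 / 2)).const_add x.ctr
  have h3 : fderiv ℝ (phase S x) p = _ := h2.fderiv
  rw [h3]
  rfl

theorem fderiv_heisA_fst {S : PSR m} (x : Heis m) {p : Amb m} (hp : p.1 ∈ caskM S) (A : Amb m) :
    (fderiv ℝ (heisA S x) p A).1 = A.1 := by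
  have h := ((heisA_contDiffAt x hp).differentiableAt (by simp)).hasFDerivAt.fst.unique
    (hasFDerivAt_fst (p := p))
  exact congrArg (fun f : Amb m →L[ℝ] CVec m => f A) h

theorem fderiv_heisA_circle {S : PSR m} (x : Heis m) {p : Amb m} (hp : p.1 ∈ caskM S)
    (A : Amb m) : (fderiv ℝ (heisA S x) p A).2.2
      = (A.2.2 + p.2.2 * (Complex.I * (fderiv ℝ (phase S x) p A : ℂ)))
        * Complex.exp (Complex.I * (phase S x p : ℂ)) := by
  have h1 := ((heisA_contDiffAt x hp).differentiableAt (by simp)).hasFDerivAt.snd.snd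
  have h2 := ((phase_contDiffAt x hp).differentiableAt (by simp)).hasFDerivAt
  have h3 : HasFDerivAt (fun p : Amb m => p.2.2) _ p :=
    (ContinuousLinearMap.snd ℝ (Cov m) ℂ ∘L ContinuousLinearMap.snd ℝ (CVec m) _).hasFDerivAt
  have h4 := h3.mul (((Complex.ofRealCLM.hasFDerivAt.comp p h2).const_mul Complex.I).cexp)
  have h := congrArg (fun f : Amb m →L[ℝ] ℂ => f A) (h1.unique h4)
  refine Eq.trans h ?_
  simp
  ring

/-- Adding a parallel one-form shifts the coefficients of `β` by a constant, which disappears on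
differentiating. -/
theorem toSplit_heisA {S : PSR m} (x : Heis m) {p : Amb m} (hp : p.1 ∈ caskM S) (A : Amb m) :
    toSplit S (heisA S x p) (fderiv ℝ (heisA S x) p A) = toSplit S p A := by
  have hd := ((heisA_contDiffAt x hp).differentiableAt (by simp)).hasFDerivAt
  have hc : DifferentiableAt ℝ (coef S) (projN m (heisA S x p)) := coef_differentiableAt hp
  have hc' : DifferentiableAt ℝ (coef S) (projN m p) := coef_differentiableAt hp
  have h1 := hc.hasFDerivAt.comp p ((projN m).hasFDerivAt.comp p hd)
  have h2 := (hc'.hasFDerivAt.comp p (projN m).hasFDerivAt).const_add x.form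
  have he : (fun q => x.form + (coef S ∘ projN m) q) =ᶠ[nhds p]
      coef S ∘ projN m ∘ heisA S x := by
    filter_upwards [continuousAt_fst.eventually (eventually_frame_isInvertible hp)] with q hq
    exact (coef_frame_add hq x.form q.2.1).symm
  have h3 := congrArg (fun f : Amb m →L[ℝ] Par m => f A) (h1.unique (h2.congr_of_eventuallyEq
    he.symm))
  refine Prod.ext (fderiv_heisA_fst x hp A) ?_
  show vert S _ _ = vert S _ _
  rw [vert_eq, vert_eq]
  exact congrArg (frame S p.1) h3

/-- The exact term of `ω_H` is pulled back from `M` and ignores vertical parts, so only `ω₁`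
contributes; `omInv_eq_neg_metInv` identifies the contribution. -/
theorem omH_vertical_add {S : PSR m} {X : CVec m} (hX : X ∈ caskM S) (u : Par m) (v : CVec m)
    (β : Cov m) (T : Split m) :
    omH S X (v, frame S X u + β) T = omH S X (v, β) T - omInv S X (frame S X u) T.2 := by
  have h : metInv S X ((frame S X u + β) ∘L cplx m) T.2
      = metInv S X (frame S X u ∘L cplx m) T.2 + metInv S X (β ∘L cplx m) T.2 := by
    rw [metInv, ContinuousLinearMap.add_comp, map_add, map_add, metInv, metInv]
  rw [omInv_eq_neg_metInv hX]
  simp only [omH, metN, cplx1, h]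
  ring

/-- The phase contributes `+½ ω⁻¹(α, ·)` to `ds` and the change of `Ξ` contributes `-½ ω⁻¹(α, ·)` to
`½ ι_Ξ ω_H`. The condition `|w| = 1` makes the angular form `Im(w̄ dw)` pick up exactly the
derivative of the phase. -/
theorem eta_heisA {S : PSR m} (x : Heis m) {p : Amb m} (hp : p.1 ∈ caskM S) (hw : ‖p.2.2‖ = 1)
    (A : Amb m) : eta S (heisA S x p) (fderiv ℝ (heisA S x) p A) = eta S p A := by
  have h1 : (conj (heisA S x p).2.2 * (fderiv ℝ (heisA S x) p A).2.2).im
      = (conj p.2.2 * A.2.2).im + fderiv ℝ (phase S x) p A := by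
    rw [fderiv_heisA_circle x hp]
    have e1 : conj (Complex.exp (Complex.I * (phase S x p : ℂ)))
        * Complex.exp (Complex.I * (phase S x p : ℂ)) = 1 := by
      rw [← Complex.exp_conj, ← Complex.exp_add]
      simp
    have e2 : conj p.2.2 * p.2.2 = 1 := by
      rw [mul_comm, Complex.mul_conj, Complex.normSq_eq_norm_sq, hw]; simp
    have e3 : conj (heisA S x p).2.2 * ((A.2.2 + p.2.2 * (Complex.I
          * (fderiv ℝ (phase S x) p A : ℂ))) * Complex.exp (Complex.I * (phase S x p : ℂ)))
        = conj p.2.2 * A.2.2 + Complex.I * (fderiv ℝ (phase S x) p A : ℂ) := by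
      have : conj (heisA S x p).2.2 = conj p.2.2
          * conj (Complex.exp (Complex.I * (phase S x p : ℂ))) := map_mul _ _ _
      rw [this]
      linear_combination (conj p.2.2 * (A.2.2 + p.2.2 * (Complex.I
          * (fderiv ℝ (phase S x) p A : ℂ)))) * e1
          + (Complex.I * (fderiv ℝ (phase S x) p A : ℂ)) * e2
    rw [e3]
    simp
  have h2 : omH S (heisA S x p).1 ((heisA S x p).1, (heisA S x p).2.1) (toSplit S p A)
      = omH S p.1 (p.1, p.2.1) (toSplit S p A)
        - sympl x.form (fderiv ℝ (coef S) (p.1, p.2.1) (A.1, A.2.1)) := by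
    refine (omH_vertical_add hp x.form p.1 p.2.1 _).trans ?_
    congr 1
    exact omInv_frame hp _ _
  rw [eta, toSplit_heisA x hp, h1, h2, fderiv_phase x hp, eta]
  ring

theorem metQ_heisA {S : PSR m} (c : ℝ) (x : Heis m) {p : Amb m} (hp : p.1 ∈ caskM S)
    (hw : ‖p.2.2‖ = 1) (A B : Amb m) :
    metQ S c (heisA S x p) (fderiv ℝ (heisA S x) p A) (fderiv ℝ (heisA S x) p B)
      = metQ S c p A B := by
  have h : (heisA S x p).1 = p.1 := rfl
  simp only [metQ, metP, theta0, theta1, theta2, theta3, eta_heisA x hp hw, toSplit_heisA x hp,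
    fderiv_heisA_fst x hp, h]

/-! ### The group action on `N̄` -/

theorem covL_one (S : PSR m) (α : Cov m) : covL S 1 α = α := by
  ext v; rw [covL_apply, inv_one, affM_one]

theorem covL_mul (S : PSR m) (g g' : AffH S) (α : Cov m) :
    covL S (g * g') α = covL S g (covL S g' α) := by
  ext v; rw [covL_apply, mul_inv_rev, affM_mul, covL_apply, covL_apply]

theorem affA_one (S : PSR m) (p : Amb m) : affA S 1 p = p := by
  rw [affA_apply, affM_one, covL_one]

theorem affA_mul (S : PSR m) (g g' : AffH S) (p : Amb m) :
    affA S (g * g') p = affA S g (affA S g' p) := by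
  simp only [affA_apply, affM_mul, covL_mul]

theorem affA_mem_Nbar {S : PSR m} {c : ℝ} (g : AffH S) {p : Amb m} (hp : p ∈ Nbar S c) :
    affA S g p ∈ Nbar S c := by
  obtain ⟨h1, h2, h3, h4⟩ := hp
  refine ⟨affM_mem_caskM S g h1, h2, ?_, ?_⟩
  -- `X⁰` is multiplied by a positive real number, so the slice `arg X⁰ = 0` is preserved.
  · exact (Complex.arg_real_mul _ (Real.rpow_pos_of_pos g.right.1.2 _)).trans h3
  · rw [← fZ_affM S c g (caskM_zero_ne h1)] at h4
    exact h4

theorem heisA_mem_Nbar {S : PSR m} {c : ℝ} (x : Heis m) {p : Amb m} (hp : p ∈ Nbar S c) :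
    heisA S x p ∈ Nbar S c := by
  obtain ⟨h1, h2, h3, h4⟩ := hp
  refine ⟨h1, ?_, h3, h4⟩
  simp [heisA, h2, Complex.norm_exp]

theorem heisA_one (S : PSR m) (p : Amb m) : heisA S 1 p = p := by
  have h : sympl (0 : Par m) (coef S (p.1, p.2.1)) = 0 := by simp [sympl]
  simp [heisA, phase, symplL_apply, h]

/-- The phase is a cocycle: evaluating the phase of `x` at the point already shifted by `y` produces
the extra `½ ω⁻¹(x, y)` of the group law. -/
theorem heisA_mul {S : PSR m} (x y : Heis m) {p : Amb m} (hp : p.1 ∈ caskM S) :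
    heisA S (x * y) p = heisA S x (heisA S y p) := by
  have hc : coef S ((heisA S y p).1, (heisA S y p).2.1) = y.form + coef S (p.1, p.2.1) :=
    coef_frame_add (frame_isInvertible hp) y.form p.2.1
  have hph : phase S (x * y) p = phase S y p + phase S x (heisA S y p) := by
    have h : ∀ w, sympl (x.form + y.form) w = sympl x.form w + sympl y.form w := fun w => by
      simp only [sympl, Prod.fst_add, Prod.snd_add, add_dotProduct]; ring
    rw [phase, phase, phase, hc, map_add]
    simp only [symplL_apply, Heis.mul_form, Heis.mul_ctr, h]
    ring
  rw [heisA, hph]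
  refine Prod.ext rfl (Prod.ext ?_ ?_)
  · show frame S p.1 (x.form + y.form) + p.2.1 = frame S p.1 x.form + (frame S p.1 y.form + p.2.1)
    rw [map_add, add_assoc]
  · show _ = p.2.2 * Complex.exp (Complex.I * (phase S y p : ℂ))
      * Complex.exp (Complex.I * (phase S x (heisA S y p) : ℂ))
    rw [mul_assoc, ← Complex.exp_add]
    push_cast
    ring_nf

/-- The compatibility needed for the semidirect product. The phases agree because `push` preserves
the symplectic form. -/
theorem affA_heisA {S : PSR m} (g : AffH S) (x : Heis m) {p : Amb m} (hp : p.1 ∈ caskM S) :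
    heisA S (heisAut S g x) (affA S g p) = affA S g (heisA S x p) := by
  have hf : frame S (affM S g p.1) (push S g x.form) = covL S g (frame S p.1 x.form) :=
    frame_push S g (caskM_zero_ne hp) x.form
  have hc : coef S ((affA S g p).1, (affA S g p).2.1) = push S g (coef S (p.1, p.2.1)) :=
    coef_covL g (y := (p.1, p.2.1)) (frame_isInvertible hp) (caskM_zero_ne hp)
  have hph : phase S (heisAut S g x) (affA S g p) = phase S x p := by
    rw [phase, phase, hc, symplL_apply, symplL_apply]
    exact congrArg (fun r => x.ctr + (1 / 2) * r) (push_sympl S g _ _)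
  rw [heisA, hph]
  refine Prod.ext rfl (Prod.ext ?_ rfl)
  show frame S (affM S g p.1) (push S g x.form) + covL S g p.2.1
    = covL S g (frame S p.1 x.form + p.2.1)
  rw [hf, map_add]

/-- The action of `Aff_H` on `N̄`. -/
def affPerm (S : PSR m) (c : ℝ) : AffH S →* Equiv.Perm (Nbar S c) where
  toFun g :=
    { toFun := fun p => ⟨affA S g p.1, affA_mem_Nbar g p.2⟩
      invFun := fun p => ⟨affA S g⁻¹ p.1, affA_mem_Nbar g⁻¹ p.2⟩
      left_inv := fun p => Subtype.ext <|
        (affA_mul S g⁻¹ g p.1).symm.trans (by rw [inv_mul_cancel, affA_one])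
      right_inv := fun p => Subtype.ext <|
        (affA_mul S g g⁻¹ p.1).symm.trans (by rw [mul_inv_cancel, affA_one]) }
  map_one' := Equiv.ext fun p => Subtype.ext (affA_one S p.1)
  map_mul' g g' := Equiv.ext fun p => Subtype.ext (affA_mul S g g' p.1)

/-- The action of the Heisenberg group on `N̄`. -/
def heisPerm (S : PSR m) (c : ℝ) : Heis m →* Equiv.Perm (Nbar S c) where
  toFun x :=
    { toFun := fun p => ⟨heisA S x p.1, heisA_mem_Nbar x p.2⟩
      invFun := fun p => ⟨heisA S x⁻¹ p.1, heisA_mem_Nbar x⁻¹ p.2⟩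
      left_inv := fun p => Subtype.ext <|
        (heisA_mul x⁻¹ x p.2.1).symm.trans (by rw [inv_mul_cancel, heisA_one])
      right_inv := fun p => Subtype.ext <|
        (heisA_mul x x⁻¹ p.2.1).symm.trans (by rw [mul_inv_cancel, heisA_one]) }
  map_one' := Equiv.ext fun p => Subtype.ext (heisA_one S p.1)
  map_mul' x y := Equiv.ext fun p => Subtype.ext (heisA_mul x y p.2.1)

theorem heisPerm_apply (S : PSR m) (c : ℝ) (x : Heis m) (p : Nbar S c) :
    (heisPerm S c x p).1 = heisA S x p.1 := rfl

theorem cyc_le_ker_heisPerm (S : PSR m) (c : ℝ) : cyc m ≤ (heisPerm S c).ker := by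
  rw [cyc, Subgroup.zpowers_le, MonoidHom.mem_ker]
  refine Equiv.ext fun p => Subtype.ext ?_
  rw [heisPerm_apply]
  have h : sympl (0 : Par m) (coef S (p.1.1, p.1.2.1)) = 0 := by simp [sympl]
  have he : Complex.exp (Complex.I * (2 * (Real.pi : ℂ))) = 1 := by
    rw [mul_comm, Complex.exp_two_pi_mul_I]
  simp [heisA, phase, symplL_apply, h, he]

/-- The action of the quotient of the Heisenberg group on `N̄`. -/
def heisQuotPerm (S : PSR m) (c : ℝ) : Heis m ⧸ cyc m →* Equiv.Perm (Nbar S c) :=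
  QuotientGroup.lift (cyc m) (heisPerm S c) (cyc_le_ker_heisPerm S c)

/-- The action of `Aff_H ⋉ (Heis/F)` on `N̄`. -/
def symPerm (S : PSR m) (c : ℝ) : SymGroup S →* Equiv.Perm (Nbar S c) :=
  SemidirectProduct.lift (heisQuotPerm S c) (affPerm S c) fun g => by
    refine MonoidHom.ext fun q => ?_
    induction q using QuotientGroup.induction_on with
    | H x =>
      show heisPerm S c (heisAut S g x) = affPerm S c g * heisPerm S c x * (affPerm S c g)⁻¹
      rw [eq_mul_inv_iff_mul_eq]
      exact Equiv.ext fun p => Subtype.ext (affA_heisA g x p.2.1)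

theorem symPerm_mk (S : PSR m) (c : ℝ) (x : Heis m) (g : AffH S) (p : Nbar S c) :
    (symPerm S c ⟨QuotientGroup.mk x, g⟩ p).1 = heisA S x (affA S g p.1) := rfl

/-! ### Effectivity -/

/-- The point `r (1, x + it)` of `ℂⁿ`. -/
def basePoint (r : ℝ) (x t : Fin m → ℝ) : CVec m :=
  (r : ℂ) • Fin.cons 1 (cv x + Complex.I • cv t)

theorem zc_basePoint {r : ℝ} (hr : 0 < r) (x t : Fin m → ℝ) :
    zc (basePoint r x t) = cv x + Complex.I • cv t := by
  have h : (r : ℂ) ≠ 0 := by exact_mod_cast hr.ne'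
  rw [zc, basePoint, ctail_smul, Fin.tail_cons, smul_smul]
  simp [h]

theorem basePoint_mem_caskM {S : PSR m} {r : ℝ} (hr : 0 < r) (x : Fin m → ℝ) {t : Fin m → ℝ}
    (ht : t ∈ S.H) : basePoint r x t ∈ caskM S := by
  have h : (r : ℂ) ≠ 0 := by exact_mod_cast hr.ne'
  refine ⟨cv x + Complex.I • cv t, ⟨1, one_pos, t, ht, ?_⟩, ?_, fun a => ?_⟩
  · ext; simp [cv]
  · simpa [basePoint] using h
  · simp [basePoint]

/-- The real part of the point contributes `2r²` to `g(X, X)` and the imaginary part `-6r²`, since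
`k(t, t, t) = 6` on `H`. -/
theorem fZ_basePoint (S : PSR m) (c : ℝ) {r : ℝ} (hr : 0 < r) (x : Fin m → ℝ) {t : Fin m → ℝ}
    (ht : t ∈ S.H) : fZ S c (basePoint r x t) = 2 * r ^ 2 - c / 2 := by
  have hX := caskM_zero_ne (basePoint_mem_caskM hr x ht)
  obtain ⟨V, _, hH⟩ := S.hypersurface
  rw [hH] at ht
  have h1 : cubic S.k t = 1 := ht.2
  have h2 : tri S.k t t t = 6 := by
    rw [cubic] at h1; linarith
  have e1 : rv (basePoint r x t) = Fin.cons r (r • x) := by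
    refine cons_ext (by simp [rv, basePoint]) ?_
    ext a; simp [rv, basePoint, Fin.tail, cv]
  have e2 : iv (basePoint r x t) = Fin.cons 0 (r • t) := by
    refine cons_ext (by simp [iv, basePoint]) ?_
    ext a; simp [iv, basePoint, Fin.tail, cv]
  have e3 : rv (cv x + Complex.I • cv t) = x := by ext; simp [rv, cv]
  have e4 : iv (cv x + Complex.I • cv t) = t := by ext; simp [iv, cv]
  have e5 : tri S.k t 0 0 = 0 := by simpa using tri_smul_right S.k t 0 0 0
  rw [fZ, metN_rotZ_rotZ S hX, metM_apply S hX, zc_basePoint hr, e1, e2, imHess_eq, imHess_eq]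
  simp only [e3, e4, Fin.tail_cons, Fin.cons_zero, sub_self, zero_smul, sub_zero, tri_smul_mid,
    tri_smul_right, e5, h2]
  ring

theorem exists_mem_Nbar (S : PSR m) {c : ℝ} (hc : 0 ≤ c) : ∃ r : ℝ, 0 < r ∧ ∃ t ∈ S.H,
    ∀ x : Fin m → ℝ, ((basePoint r x t, 0, 1) : Amb m) ∈ Nbar S c := by
  obtain ⟨t, ht⟩ := S.nonempty
  have hr : 0 < 1 + c := by linarith
  -- With `r = 1 + c` and `c ≥ 0`, the value `2r² - c/2` of `fZ` is positive.
  refine ⟨1 + c, hr, t, ht, fun x => ⟨basePoint_mem_caskM hr x ht, by simp, ?_, ?_⟩⟩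
  · have h : basePoint (1 + c) x t 0 = ((1 + c : ℝ) : ℂ) := by simp [basePoint]
    show (basePoint (1 + c) x t 0).arg = 0
    rw [h, Complex.arg_ofReal_of_nonneg hr.le]
  · show 0 < fZ S c (basePoint (1 + c) x t)
    rw [fZ_basePoint S c hr x ht]
    nlinarith

/-- The zeroth coordinate forces the scaling factor to be 1. The real part of `z` then gives `A x +
b = x` for every `x`; the choice `x = 0` gives `b = 0`, and so `A = 1`. -/
theorem eq_one_of_affM_basePoint {S : PSR m} (g : AffH S) {r : ℝ} (hr : 0 < r) {t : Fin m → ℝ}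
    (h : ∀ x, affM S g (basePoint r x t) = basePoint r x t) : g = 1 := by
  have hr' : (r : ℂ) ≠ 0 := by exact_mod_cast hr.ne'
  have h0 : g.right.1.val = 1 := by
    have e := congrFun (h 0) 0
    have e' : ((g.right.1.val ^ (-(3 / 2) : ℝ) : ℝ) : ℂ) * basePoint r 0 t 0 = basePoint r 0 t 0 :=
      e
    have hb : basePoint r 0 t 0 = (r : ℂ) := by simp [basePoint]
    rw [hb] at e'
    have e2 : g.right.1.val ^ (-(3 / 2) : ℝ) = 1 := by
      exact_mod_cast mul_right_cancel₀ hr' (e'.trans (one_mul _).symm)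
    exact (Real.rpow_left_inj g.right.1.2.le zero_le_one (by norm_num)).1
      (e2.trans (Real.one_rpow _).symm)
  have hne : ∀ x, basePoint r x t 0 ≠ 0 := fun x => by simpa [basePoint] using hr'
  have h1 : ∀ x, g.right.2.val.val *ᵥ x + g.left.toAdd = x := fun x => by
    have e := congrArg zc (h x)
    rw [zc_affM S g (hne x), zc_basePoint hr, h0] at e
    have e1 := congrArg rv e
    have e2 : rv (cv x + Complex.I • cv t) = x := by ext; simp [rv, cv]
    rw [e2] at e1
    conv_rhs => rw [← e1]
    rw [Complex.ofReal_one, one_smul]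
    have e3 := rv_cAct g.right.2.val (cv x + Complex.I • cv t)
    rw [e2] at e3
    rw [← e3]
    ext; simp [rv, cv]
  have hb : g.left.toAdd = 0 := by simpa using h1 0
  refine SemidirectProduct.ext ?_ (Prod.ext (Subtype.ext h0) (Subtype.ext (Units.ext ?_)))
  · exact hb
  · refine Matrix.mulVec_injective (funext fun x => ?_)
    have := h1 x
    rw [hb, add_zero] at this
    simpa using this

theorem mk_eq_one_of_exp {τ : ℝ} (h : Complex.exp (Complex.I * (τ : ℂ)) = 1) :
    (QuotientGroup.mk (⟨0, τ⟩ : Heis m) : Heis m ⧸ cyc m) = 1 := by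
  rw [Complex.exp_eq_one_iff] at h
  obtain ⟨n, hn⟩ := h
  have hτ : τ = n * (2 * Real.pi) := by
    have h2 : (τ : ℂ) = n * (2 * Real.pi) :=
      mul_left_cancel₀ Complex.I_ne_zero (hn.trans (by ring))
    exact_mod_cast h2
  -- The centre as a one-parameter subgroup, so that the `n`-th power of the generator is the
  -- element with central coordinate `2πn`.
  let φ : Multiplicative ℝ →* Heis m :=
    { toFun := fun s => ⟨0, s.toAdd⟩
      map_one' := rfl
      map_mul' := fun s s' => by ext1 <;> simp [sympl] }
  rw [QuotientGroup.eq_one_iff, cyc, Subgroup.mem_zpowers_iff]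
  refine ⟨n, ?_⟩
  have h3 := map_zpow φ (Multiplicative.ofAdd (2 * Real.pi)) n
  rw [← ofAdd_zsmul] at h3
  refine h3.symm.trans ?_
  show (⟨0, n • (2 * Real.pi)⟩ : Heis m) = _
  rw [zsmul_eq_mul, hτ]

theorem symPerm_effective (S : PSR m) {c : ℝ} (hc : 0 ≤ c) (γ : SymGroup S)
    (h : ∀ p, symPerm S c γ p = p) : γ = 1 := by
  obtain ⟨q, g⟩ := γ
  induction q using QuotientGroup.induction_on with
  | H x =>
    obtain ⟨r, hr, t, ht, hmem⟩ := exists_mem_Nbar S hc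
    have hp : ∀ p ∈ Nbar S c, heisA S x (affA S g p) = p := fun p hp =>
      congrArg Subtype.val (h ⟨p, hp⟩)
    -- Heisenberg elements fix the `M`-component, so the fixed-point equation constrains `g` alone
    -- there.
    have hg : g = 1 :=
      eq_one_of_affM_basePoint g hr fun y => congrArg Prod.fst (hp _ (hmem y))
    subst hg
    have h1 := hp _ (hmem 0)
    rw [affA_one] at h1
    have hX := basePoint_mem_caskM hr 0 ht
    have hf : x.form = 0 := by
      have e : frame S (basePoint r 0 t) x.form + 0 = 0 := congrArg (fun p : Amb m => p.2.1) h1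
      rw [add_zero] at e
      exact (map_eq_zero_iff _ (frame_isInvertible hX).injective).1 e
    obtain ⟨u, τ⟩ := x
    obtain rfl : u = 0 := hf
    have e : (1 : ℂ) * Complex.exp (Complex.I * (phase S ⟨0, τ⟩ (basePoint r 0 t, 0, 1) : ℂ)) = 1 :=
      congrArg (fun p : Amb m => p.2.2) h1
    have e1 : phase S ⟨0, τ⟩ (basePoint r 0 t, 0, 1) = τ := by
      simp [phase, symplL_apply, sympl]
    rw [one_mul, e1] at e
    rw [mk_eq_one_of_exp e]
    rfl

/-! ### Isometry -/

/-- The formulas of the action already make sense near `N̄` in the ambient space. At points of `N̄`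
the metric identity holds for all ambient vectors, so tangent vectors need no separate treatment. -/
theorem exists_isometric_smoothExt (S : PSR m) (c : ℝ) (γ : SymGroup S) :
    ∃ F, SmoothExt S c (symPerm S c γ) F ∧ ∀ (x : Nbar S c) (A B : Amb m),
      metQ S c (symPerm S c γ x).1 (fderiv ℝ F x.1 A) (fderiv ℝ F x.1 B) = metQ S c x.1 A B := by
  obtain ⟨q, g⟩ := γ
  induction q using QuotientGroup.induction_on with
  | H x =>
    refine ⟨heisA S x ∘ affA S g, fun p => ⟨rfl, ?_⟩, fun p A B => ?_⟩
    · exact ContDiffAt.comp _ (heisA_contDiffAt x (affA_mem_Nbar g p.2).1)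
        (affA S g).contDiff.contDiffAt
    · have hm := affA_mem_Nbar g p.2
      have hd := ((heisA_contDiffAt x hm.1).differentiableAt (by simp)).hasFDerivAt.comp p.1
        (affA S g).hasFDerivAt
      rw [hd.fderiv, symPerm_mk]
      exact (metQ_heisA c x hm.1 hm.2.1 _ _).trans (metQ_affA c g p.2.1 A B)

/-- The inverse is smooth because it is the action of `γ⁻¹`. -/
theorem symPerm_isIsometryNbar (S : PSR m) (c : ℝ) (γ : SymGroup S) :
    IsIsometryNbar S c (symPerm S c γ) := by
  refine ⟨?_, ?_⟩
  · obtain ⟨F, hF, -⟩ := exists_isometric_smoothExt S c γ⁻¹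
    rw [map_inv] at hF
    exact ⟨F, hF⟩
  · obtain ⟨F, hF, hm⟩ := exists_isometric_smoothExt S c γ
    exact ⟨F, hF, fun x A _ B _ => hm x A B⟩

end

end QMap

/-! ### The main theorem. -/

theorem mainTheorem1 {m : ℕ} (S : QMap.PSR m) (c : ℝ) (hc : 0 ≤ c) :
    ∃ _act : MulAction (QMap.SymGroup S) (QMap.Nbar S c),
      -- the action is the restriction to `N̄` of the natural action on `P`
      (∀ (g : QMap.AffH S) (p : QMap.Nbar S c),
        ((SemidirectProduct.inr g : QMap.SymGroup S) • p).1 = QMap.affP S g p.1) ∧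
      (∀ (x : QMap.Heis m) (p : QMap.Nbar S c),
        ((SemidirectProduct.inl (QuotientGroup.mk x) : QMap.SymGroup S) • p).1
          = QMap.heisP S x p.1) ∧
      -- it is effective
      (∀ γ : QMap.SymGroup S, (∀ p : QMap.Nbar S c, γ • p = p) → γ = 1) ∧
      -- it is isometric
      (∀ γ : QMap.SymGroup S, QMap.IsIsometryNbar S c (MulAction.toPerm γ)) := by
  let act := MulAction.compHom (QMap.Nbar S c) (QMap.symPerm S c)
  have hsmul : ∀ (γ : QMap.SymGroup S) (p : QMap.Nbar S c), γ • p = QMap.symPerm S c γ p :=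
    fun _ _ => rfl
  refine ⟨act, fun g p => ?_, fun x p => ?_, fun γ h => ?_, fun γ => ?_⟩
  · rw [hsmul, QMap.affP_eq]
    exact QMap.heisA_one S _
  · rw [hsmul, QMap.heisP_eq x p.2.1]
    exact congrArg (QMap.heisA S x) (QMap.affA_one S p.1)
  · exact QMap.symPerm_effective S hc γ h
  · have h : MulAction.toPerm γ = QMap.symPerm S c γ := Equiv.ext fun p => hsmul γ p
    rw [h]
    exact QMap.symPerm_isIsometryNbar S c γ
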